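/- Let $N\ge 1$, $0<\alpha\le\beta<\infty$, $0<R<1$, $\theta=R^N$, $Y=[0,1]^N$. Let $\{B(y^p,\varepsilon_p)\}_{p\in K}$, with $K$ countable and $\varepsilon_p>0$, be a family of pairwise disjoint open balls that covers $\mathbb{R}^N$ up to a Lebesgue-null set and is invariant under $\mathbb{Z}^N$-translations: for all $p\in K$ and $k\in\mathbb{Z}^N$ the ball $B(y^p+k,\varepsilon_p)$ belongs to the family. Let $a_B=\alpha$ for $|y|<R$ and $a_B=\beta$ for $R<|y|<1$, and let $a_{\mathbb{R}^N}(y)=a_B\big(\tfrac{y-y^p}{\varepsilon_p}\big)$ for $y\in B(y^p,\varepsilon_p)$, $p\in K$. For $m>0$, $e\in\mathbb{R}^N$, consider $$(\ast)\qquad -\mathrm{div}(a_B\nabla w_e)=0\ \text{ in }\mathbb{R}^N,\qquad w_e(y)=e\cdot y\ \text{ in }\mathbb{R}^N\setminus B(0,1),\qquad w_e\in H^1_{loc}(\mathbb{R}^N),$$ where $a_B$ is extended by $m$ to $\mathbb{R}^N\setminus B(0,1)$; $a_B$ is called equivalent to $m$ if $(\ast)$ has a weak solution for every $e\in\mathbb{R}^N$.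 Let $H^1_\#(Y)$ be the space of $Y$-periodic (that is, $\mathbb{Z}^N$-periodic) functions in $H^1_{loc}(\mathbb{R}^N)$. Then $a_{\mathbb{R}^N}$ is $Y$-periodic; there is exactly one $m>0$ to which $a_B$ is equivalent; it satisfies $\alpha\le m\le\beta$ and is the unique solution of $$\frac{m-\beta}{m+(N-1)\beta}=\theta\,\frac{\alpha-\beta}{\alpha+(N-1)\beta};$$ and the following hold. (1) For each $e\in\mathbb{R}^N$ and each solution $w_e$ of $(\ast)$ with this $m$, the function $$\chi(y)=\varepsilon_p\Big(w_e\Big(\frac{y-y^p}{\varepsilon_p}\Big)-e\cdot\frac{y-y^p}{\varepsilon_p}\Big),\qquad y\in B(y^p,\varepsilon_p),\ p\in K,$$ is $Y$-periodic, belongs to $H^1_{loc}(\mathbb{R}^N)$ with $\nabla\chi(y)=\nabla w_e\big(\tfrac{y-y^p}{\varepsilon_p}\big)-e$ in $B(y^p,\varepsilon_p)$, and satisfies $-\mathrm{div}\big(a_{\mathbb{R}^N}(\nabla\chi+e)\big)=0$ in $\mathbb{R}^N$ in the sense of distributions. Moreover $\chi_e=\chi-\frac1{|Y|}\int_Y\chi\,dy$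 solves the cell problem $$\chi_e\in H^1_\#(Y),\qquad \int_Y\chi_e\,dy=0,\qquad \int_Y a_{\mathbb{R}^N}(\nabla\chi_e+e)\cdot\nabla\varphi\,dy=0\quad\text{for all }\varphi\in H^1_\#(Y).$$ (2) The homogenized matrix is $m$ times the identity: for all $e,e'\in\mathbb{R}^N$ and all solutions $\chi_e,\chi_{e'}$ of the corresponding cell problems, $$\frac1{|Y|}\int_Y a_{\mathbb{R}^N}(y)(\nabla\chi_e+e)\cdot(\nabla\chi_{e'}+e')\,dy=m\,e\cdot e'.$$ In particular, for each canonical basis vector $e_l$, the homogenized coefficient $a^*=\frac1{|Y|}\int_Y a_{\mathbb{R}^N}|\nabla\chi_{e_l}+e_l|^2\,dy$ equals $m$. -/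

import Mathlib

open MeasureTheory Metric Set
open scoped ContDiff

/-- Euclidean space `ℝ^N`. -/
abbrev E (N : ℕ) := EuclideanSpace ℝ (Fin N)

/-- The closed unit cell `Y = [0,1]^N`. -/
def unitCell (N : ℕ) : Set (E N) := {x | ∀ i, x i ∈ Icc (0 : ℝ) 1}

/-- An integer vector regarded as a point of `ℝ^N`. -/
def latticePt {N : ℕ} (k : Fin N → ℤ) : E N := WithLp.toLp 2 (fun i => (k i : ℝ))

/-- Smooth compactly supported test functions on `ℝ^N`. -/
def IsTestFun {N : ℕ} (φ : E N → ℝ) : Prop := ContDiff ℝ ∞ φ ∧ HasCompactSupport φ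

/-- `u ∈ H¹_loc(ℝ^N)` with weak gradient `g`. -/
structure MemH1loc {N : ℕ} (u : E N → ℝ) (g : E N → E N) : Prop where
  memLp_fun : ∀ K : Set (E N), IsCompact K → MemLp u 2 (volume.restrict K)
  memLp_grad : ∀ K : Set (E N), IsCompact K → MemLp g 2 (volume.restrict K)
  weak_grad : ∀ φ : E N → ℝ, IsTestFun φ →
    ∫ x, u x • gradient φ x = -∫ x, φ x • g x

/-- `u ∈ H¹_#(Y)` with weak gradient `g`: the `Y`-periodic elements of `H¹_loc(ℝ^N)`. -/
structure MemH1per {N : ℕ} (u : E N → ℝ) (g : E N → E N) : Prop where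
  memH1loc : MemH1loc u g
  periodic : ∀ k : Fin N → ℤ, ∀ᵐ x, u (x + latticePt k) = u x

/-- `-div (a F) = 0` in `ℝ^N` in the sense of distributions. -/
def IsDivFree {N : ℕ} (a : E N → ℝ) (F : E N → E N) : Prop :=
  ∀ φ : E N → ℝ, IsTestFun φ → ∫ x, a x * inner ℝ (F x) (gradient φ x) = 0

/-- The two-phase profile `a_B` on the unit ball: core `α`, coating `β`. -/
noncomputable def profile {N : ℕ} (α β R : ℝ) (y : E N) : ℝ := if ‖y‖ < R then α else β

/-- `a_B` extended by the constant `m` outside the unit ball. -/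
noncomputable def profileExt {N : ℕ} (α β R m : ℝ) (y : E N) : ℝ :=
  if ‖y‖ < 1 then profile α β R y else m

/-- `w ∈ H¹_loc(ℝ^N)`, with weak gradient `g`, solves `-div (a_B ∇w) = 0` in `ℝ^N` and
`w = e · y` outside the unit ball, where `a_B` is extended by `m`. -/
structure IsBallSolution {N : ℕ} (α β R m : ℝ) (e : E N) (w : E N → ℝ) (g : E N → E N) :
    Prop where
  memH1loc : MemH1loc w g
  outside : ∀ᵐ y : E N, 1 ≤ ‖y‖ → w y = inner ℝ e y
  equation : IsDivFree (profileExt α β R m) g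

/-- The profile `a_B` on the unit ball of `ℝ^N` is equivalent to the constant `m > 0`. -/
def IsEquivalentTo (N : ℕ) (α β R m : ℝ) : Prop :=
  0 < m ∧ ∀ e : E N, ∃ w g, IsBallSolution α β R m e w g

/-- A family of disjoint balls `B(c p, ρ p)` covering `ℝ^N` up to a null set and invariant
under `ℤ^N`-translations. -/
structure IsPeriodicBallCover {N : ℕ} {ι : Type*} (c : ι → E N) (ρ : ι → ℝ) : Prop where
  radius_pos : ∀ p, 0 < ρ p
  disjoint : Pairwise fun p q => Disjoint (ball (c p) (ρ p)) (ball (c q) (ρ q))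
  covers : volume (⋃ p, ball (c p) (ρ p))ᶜ = 0
  translate : ∀ (k : Fin N → ℤ) (p : ι), ∃ q, c q = c p + latticePt k ∧ ρ q = ρ p

open Classical in
/-- The function equal to `x ↦ F p ((x - c p) / ρ p)` on each ball `B(c p, ρ p)`
(the balls being disjoint), and to `0` off the balls. -/
noncomputable def paste {N : ℕ} {ι : Type*} {V : Type*} [Zero V] (c : ι → E N) (ρ : ι → ℝ)
    (F : ι → E N → V) (x : E N) : V :=
  if h : ∃ p, x ∈ ball (c p) (ρ p) then
    F h.choose ((ρ h.choose)⁻¹ • (x - c h.choose)) else 0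

theorem paste_eq {N : ℕ} {ι : Type*} {V : Type*} [Zero V] {c : ι → E N} {ρ : ι → ℝ}
    (hc : IsPeriodicBallCover c ρ) (F : ι → E N → V) {x : E N} {p : ι}
    (hx : x ∈ ball (c p) (ρ p)) : paste c ρ F x = F p ((ρ p)⁻¹ • (x - c p)) := by
  have h : ∃ p, x ∈ ball (c p) (ρ p) := ⟨p, hx⟩
  have hp : h.choose = p := by
    by_contra hne
    exact Set.disjoint_left.1 (hc.disjoint hne) h.choose_spec hx
  rw [paste, dif_pos h, hp]

/-- The Hashin–Shtrikman coefficient `a(x) = a_B((x - c p) / ρ p)` on `B(c p, ρ p)`. -/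
noncomputable def hsCoeff {N : ℕ} {ι : Type*} (α β R : ℝ) (c : ι → E N) (ρ : ι → ℝ) :
    E N → ℝ :=
  paste c ρ fun _ z => profile α β R z

/-- The rescaled corrector `χ(x) = ρ p (w(z) - e · z)`, `z = (x - c p) / ρ p`,
on `B(c p, ρ p)`. -/
noncomputable def hsCorrector {N : ℕ} {ι : Type*} (c : ι → E N) (ρ : ι → ℝ) (e : E N)
    (w : E N → ℝ) : E N → ℝ :=
  paste c ρ fun p z => ρ p * (w z - inner ℝ e z)

/-- The field `g(z) - e`, `z = (x - c p) / ρ p`, on `B(c p, ρ p)`. -/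
noncomputable def hsCorrectorGrad {N : ℕ} {ι : Type*} (c : ι → E N) (ρ : ι → ℝ) (e : E N)
    (g : E N → E N) : E N → E N :=
  paste c ρ fun _ z => g z - e

/-- `χ ∈ H¹_#(Y)`, with weak gradient `g`, solves the cell problem
`-div (a (∇χ + e)) = 0` in `Y`, `∫_Y χ = 0`, tested against all of `H¹_#(Y)`. -/
structure IsCellSolution {N : ℕ} (a : E N → ℝ) (e : E N) (χ : E N → ℝ) (g : E N → E N) :
    Prop where
  memH1per : MemH1per χ g
  mean_zero : ∫ x in unitCell N, χ x = 0
  equation : ∀ (φ : E N → ℝ) (h : E N → E N), MemH1per φ h →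
    ∫ x in unitCell N, a x * inner ℝ (g x + e) (h x) = 0

/-!
The argument rests on one identity on the unit ball. If `w`, with weak gradient `g`, solves the
transmission problem with data `e`, then the field `a_B g - m e` vanishes outside the ball and is
divergence-free in the whole space. It is therefore orthogonal in `L²` to every weak gradient `h`,
whatever the boundary values, so that

  `∫_B a_B g · h = m ∫_B e · h`        (`IsBallSolution.integral_flux`).

The passage from test functions to weak gradients is `integral_inner_grad_eq_zero`: the correlation
of the field with translates of `h` is continuous and has mean zero against every mollifier.

Rescaling gives the same identity on each ball of the family. Since `w - e · y` vanishes outside the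
unit ball, its rescaled copies paste to an `H¹_loc` function (`memH1loc_paste`), the required `L²`
bounds coming from the fact that the radii are at most `1`. Summing the identity over the balls
shows that the pasted flux is divergence-free. For periodic integrands the unit cell may be replaced
by a union of representatives of the balls modulo translations, which is another fundamental domain
of `ℤ^N`; so the identity also holds over the unit cell (`integral_flux_unitCell`). Applied to
periodic gradients, which have mean zero, it is the cell equation; applied to constant fields, it
computes the effective coefficient. For arbitrary cell solutions, the symmetry of the energy reduces
the computation to the pasted corrector (`average_flux_eq`).

Testing the identity for one constant with a solution for another shows that the equivalent constant
is unique (`IsEquivalentTo.unique`). For existence, take `w = e · y - C (e · y) P`, where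
`P = 1 - r^{-N}` in the coating `R < r < 1` and is extended continuously by constants. When `C` and
`m` make the flux continuous across both interfaces, `a_B g - m e` is the divergence of the
antisymmetric Lipschitz matrix field `β C P (e ⊗ y - y ⊗ e)`, hence divergence-free
(`isBallSolution_explicit`); no surface integral is needed.
-/

/-! ### Locally square-integrable functions -/

/-- Square-integrability on every compact subset of `ℝ^N`. -/
def LocL2 {N : ℕ} {V : Type*} [NormedAddCommGroup V] (f : E N → V) : Prop :=
  ∀ K : Set (E N), IsCompact K → MemLp f 2 (volume.restrict K)

section LocL2

variable {N : ℕ} {V : Type*} [NormedAddCommGroup V] {f g : E N → V}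

theorem LocL2.locallyIntegrable (hf : LocL2 f) : LocallyIntegrable f volume := by
  rw [locallyIntegrable_iff]
  intro K hK
  have : IsFiniteMeasure (volume.restrict K) := ⟨by simpa using hK.measure_lt_top⟩
  exact (hf K hK).integrable (by norm_num)

theorem LocL2.aestronglyMeasurable (hf : LocL2 f) : AEStronglyMeasurable f volume :=
  hf.locallyIntegrable.aestronglyMeasurable

theorem LocL2.congr_ae (hf : LocL2 f) (h : f =ᵐ[volume] g) : LocL2 g := fun K hK =>
  (memLp_congr_ae (ae_restrict_of_ae h)).1 (hf K hK)

theorem LocL2.sub (hf : LocL2 f) (hg : LocL2 g) : LocL2 (fun x => f x - g x) := fun K hK =>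
  (hf K hK).sub (hg K hK)

theorem LocL2.add (hf : LocL2 f) (hg : LocL2 g) : LocL2 (fun x => f x + g x) := fun K hK =>
  (hf K hK).add (hg K hK)

theorem LocL2.const_smul [NormedSpace ℝ V] (hf : LocL2 f) (c : ℝ) : LocL2 (fun x => c • f x) :=
  fun K hK => (hf K hK).const_smul c

theorem Continuous.locL2 (hf : Continuous f) : LocL2 f := by
  intro K hK
  have : IsFiniteMeasure (volume.restrict K) := ⟨by simpa using hK.measure_lt_top⟩
  obtain ⟨C, hC⟩ := hK.exists_bound_of_continuousOn hf.continuousOn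
  exact MemLp.of_bound (hf.continuousOn.aestronglyMeasurable_of_isCompact hK hK.measurableSet) C
    ((ae_restrict_iff' hK.measurableSet).2 (Filter.Eventually.of_forall hC))

/-- A bounded measurable coefficient preserves local square-integrability. -/
theorem LocL2.bdd_smul [NormedSpace ℝ V] (hf : LocL2 f) {a : E N → ℝ} {C : ℝ}
    (ha : AEStronglyMeasurable a volume) (hC : ∀ x, |a x| ≤ C) : LocL2 (fun x => a x • f x) :=
  fun K hK => MemLp.smul (hf K hK)
    (memLp_top_of_bound ha.restrict C (Filter.Eventually.of_forall hC))

theorem LocL2.integrableOn_inner {f g : E N → E N} (hf : LocL2 f) (hg : LocL2 g) {s : Set (E N)}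
    (hs : Bornology.IsBounded s) : IntegrableOn (fun x => inner ℝ (f x) (g x)) s volume := by
  have hK : IsCompact (closure s) := hs.isCompact_closure
  have h : MemLp (fun x => inner ℝ (f x) (g x)) 1 (volume.restrict (closure s)) :=
    MemLp.of_bilin (p := 2) (q := 2) (fun x y => inner ℝ x y) 1 (hf _ hK) (hg _ hK)
      ((hf _ hK).1.inner (hg _ hK).1)
      (Filter.Eventually.of_forall fun x => by
        simpa [← NNReal.coe_le_coe] using norm_inner_le_norm (𝕜 := ℝ) (f x) (g x))
  exact IntegrableOn.mono_set (memLp_one_iff_integrable.1 h) subset_closure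

theorem LocL2.locallyIntegrable_inner {f : E N → E N} (hf : LocL2 f) (v : E N) :
    LocallyIntegrable (fun x => inner ℝ v (f x)) volume := by
  rw [locallyIntegrable_iff]
  intro K hK
  exact (continuous_const.locL2).integrableOn_inner hf hK.isBounded

theorem integral_comp_affine [NormedSpace ℝ V] (f : E N → V) (s : ℝ) (b : E N) :
    ∫ x, f (s • x + b) = |(s ^ N)⁻¹| • ∫ x, f x := by
  have h := Measure.integral_comp_smul (volume : Measure (E N)) (fun y => f (y + b)) s
  rw [integral_add_right_eq_self (fun y => f y) b] at h
  simpa using h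

theorem map_affine_volume {s : ℝ} (hs : s ≠ 0) (b : E N) :
    Measure.map (fun x : E N => s • x + b) volume = ENNReal.ofReal |(s ^ N)⁻¹| • volume := by
  have h : (fun x : E N => s • x + b) = (fun y => y + b) ∘ (fun x => s • x) := rfl
  rw [h, ← Measure.map_map (by fun_prop) (by fun_prop), Measure.map_addHaar_smul _ hs,
    Measure.map_smul, map_add_right_eq_self]
  simp

/-- The affine map `x ↦ s x + b`, `s ≠ 0`, as a homeomorphism of `ℝ^N`. -/
noncomputable def affineHomeo {s : ℝ} (hs : s ≠ 0) (b : E N) : E N ≃ₜ E N :=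
  (Homeomorph.smulOfNeZero s hs).trans (Homeomorph.addRight b)

theorem affineHomeo_apply {s : ℝ} (hs : s ≠ 0) (b x : E N) : affineHomeo hs b x = s • x + b := rfl

theorem LocL2.comp_affine (hf : LocL2 f) {s : ℝ} (hs : s ≠ 0) (b : E N) :
    LocL2 (fun x => f (s • x + b)) := by
  intro K hK
  have hT := (affineHomeo hs b).measurableEmbedding
  have hK' : IsCompact (affineHomeo hs b '' K) := hK.image (affineHomeo hs b).continuous
  have h := hT.restrict_map volume (affineHomeo hs b '' K)
  rw [preimage_image_eq _ (affineHomeo hs b).injective] at h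
  have h2 : MemLp f 2 (Measure.map (affineHomeo hs b) (volume.restrict K)) := by
    rw [← h, show Measure.map (affineHomeo hs b) volume = _ from map_affine_volume hs b,
      Measure.restrict_smul]
    exact (hf _ hK').smul_measure (by simp)
  exact (hT.memLp_map_measure_iff).1 h2

theorem ae_comp_affine {p : E N → Prop} (hp : ∀ᵐ x, p x) {s : ℝ} (hs : s ≠ 0) (b : E N) :
    ∀ᵐ x : E N, p (s • x + b) := by
  have h : ∀ᵐ y ∂(Measure.map (affineHomeo hs b) volume), p y := by
    rw [show Measure.map (affineHomeo hs b) volume = _ from map_affine_volume hs b]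
    exact Measure.ae_smul_measure hp _
  exact (affineHomeo hs b).measurableEmbedding.ae_map_iff.1 h

end LocL2

/-! ### Test functions -/

section TestFun

variable {N : ℕ}

theorem real_inner_gradient_right (φ : E N → ℝ) (x v : E N) :
    inner ℝ v (gradient φ x) = fderiv ℝ φ x v := by
  rw [real_inner_comm, inner_gradient_left]

theorem gradient_comp_affine {φ : E N → ℝ} (hφ : Differentiable ℝ φ) (s : ℝ) (b x : E N) :
    gradient (fun y => φ (s • y + b)) x = s • gradient φ (s • x + b) := by
  refine ext_inner_right ℝ fun v => ?_
  rw [inner_gradient_left, real_inner_smul_left, inner_gradient_left]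
  have h1 : HasFDerivAt (fun y : E N => s • y + b) (s • ContinuousLinearMap.id ℝ (E N)) x :=
    ((hasFDerivAt_id x).const_smul s).add_const b
  have h := (hφ (s • x + b)).hasFDerivAt.comp x h1
  rw [show (fun y => φ (s • y + b)) = φ ∘ fun y => s • y + b from rfl, h.fderiv]
  simp

theorem ContDiff.continuous_gradient {φ : E N → ℝ} (hφ : ContDiff ℝ ∞ φ) :
    Continuous (gradient φ) :=
  (InnerProductSpace.toDual ℝ (E N)).symm.continuous.comp (hφ.continuous_fderiv (by simp))

theorem IsTestFun.continuous {φ : E N → ℝ} (hφ : IsTestFun φ) : Continuous φ := hφ.1.continuous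

theorem IsTestFun.differentiable {φ : E N → ℝ} (hφ : IsTestFun φ) : Differentiable ℝ φ :=
  hφ.1.differentiable (by simp)

theorem IsTestFun.hasCompactSupport_gradient {φ : E N → ℝ} (hφ : IsTestFun φ) :
    HasCompactSupport (gradient φ) :=
  (hφ.2.fderiv ℝ).comp_left (g := (InnerProductSpace.toDual ℝ (E N)).symm) (by simp)

theorem IsTestFun.comp_affine {φ : E N → ℝ} (hφ : IsTestFun φ) {s : ℝ} (hs : s ≠ 0) (b : E N) :
    IsTestFun (fun x => φ (s • x + b)) :=
  ⟨hφ.1.comp (by fun_prop), hφ.2.comp_homeomorph (affineHomeo hs b)⟩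

theorem IsTestFun.smooth_mul {φ ψ : E N → ℝ} (hφ : IsTestFun φ) (hψ : ContDiff ℝ ∞ ψ) :
    IsTestFun (fun x => ψ x * φ x) :=
  ⟨hψ.mul hφ.1, hφ.2.mul_left⟩

theorem IsTestFun.fderiv_apply {φ : E N → ℝ} (hφ : IsTestFun φ) (v : E N) :
    IsTestFun (fun x => fderiv ℝ φ x v) :=
  ⟨(hφ.1.fderiv_right (m := ∞) (by simp)).clm_apply contDiff_const,
    (hφ.2.fderiv ℝ).comp_left (g := fun L : E N →L[ℝ] ℝ => L v) (by simp)⟩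

theorem IsTestFun.fderiv_self {φ : E N → ℝ} (hφ : IsTestFun φ) :
    IsTestFun (fun x => fderiv ℝ φ x x) := by
  refine ⟨(hφ.1.fderiv_right (m := ∞) (by simp)).clm_apply contDiff_id,
    (hφ.2.fderiv ℝ).mono fun x hx h0 => hx ?_⟩
  simp [h0]

theorem IsTestFun.integral_mul_fderiv {u φ : E N → ℝ} (hφ : IsTestFun φ) (hu : ContDiff ℝ ∞ u)
    (v : E N) : ∫ x, u x * fderiv ℝ φ x v = -∫ x, fderiv ℝ u x v * φ x := by
  have hu' : Continuous fun x => fderiv ℝ u x v :=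
    (hu.continuous_fderiv (by simp)).clm_apply continuous_const
  refine integral_mul_fderiv_eq_neg_fderiv_mul_of_integrable ?_ ?_ ?_
    (fun x _ => hu.differentiable (by simp) x) (fun x _ => hφ.differentiable x)
  · exact (hu'.mul hφ.continuous).integrable_of_hasCompactSupport hφ.2.mul_left
  · exact (hu.continuous.mul (hφ.fderiv_apply v).continuous).integrable_of_hasCompactSupport
      (hφ.fderiv_apply v).2.mul_left
  · exact (hu.continuous.mul hφ.continuous).integrable_of_hasCompactSupport hφ.2.mul_left

theorem IsTestFun.integral_fderiv_eq_zero {φ : E N → ℝ} (hφ : IsTestFun φ) (v : E N) :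
    ∫ x, fderiv ℝ φ x v = 0 := by
  simpa using hφ.integral_mul_fderiv (contDiff_const (c := (1 : ℝ))) v

theorem IsTestFun.integral_inner_gradient_eq_zero {φ : E N → ℝ} (hφ : IsTestFun φ) (v : E N) :
    ∫ x, inner ℝ v (gradient φ x) = 0 := by
  simpa only [real_inner_gradient_right] using hφ.integral_fderiv_eq_zero v

end TestFun

/-! ### Weak gradients -/

section WeakGradient

variable {N : ℕ} {u u' : E N → ℝ} {g g' : E N → E N}

theorem MemH1loc.locL2_fun (h : MemH1loc u g) : LocL2 u := h.memLp_fun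

theorem MemH1loc.locL2_grad (h : MemH1loc u g) : LocL2 g := h.memLp_grad

theorem LocL2.integrable_smul_test {V : Type*} [NormedAddCommGroup V] [NormedSpace ℝ V]
    {f : E N → V} (hf : LocL2 f) {ψ : E N → ℝ} (hψ : Continuous ψ) (hs : HasCompactSupport ψ) :
    Integrable (fun x => ψ x • f x) :=
  hf.locallyIntegrable.integrable_smul_left_of_hasCompactSupport hψ hs

theorem LocL2.integrable_smul_gradient (hu : LocL2 u) {φ : E N → ℝ} (hφ : IsTestFun φ) :
    Integrable (fun x => u x • gradient φ x) :=
  hu.locallyIntegrable.integrable_smul_right_of_hasCompactSupport hφ.1.continuous_gradient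
    hφ.hasCompactSupport_gradient

theorem LocL2.integrable_inner_gradient {F : E N → E N} (hF : LocL2 F) {φ : E N → ℝ}
    (hφ : IsTestFun φ) : Integrable (fun x => inner ℝ (F x) (gradient φ x)) := by
  have h := hF.integrableOn_inner hφ.1.continuous_gradient.locL2
    (s := tsupport (gradient φ)) hφ.hasCompactSupport_gradient.isCompact.isBounded
  refine (integrableOn_iff_integrable_of_support_subset fun x hx => ?_).1 h
  refine subset_tsupport _ fun h0 => hx ?_
  simp [h0]

/-- The weak gradient, tested in a direction `v`. -/
theorem MemH1loc.integral_mul_fderiv (h : MemH1loc u g) {φ : E N → ℝ} (hφ : IsTestFun φ)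
    (v : E N) : ∫ x, u x * fderiv ℝ φ x v = -∫ x, φ x * inner ℝ (g x) v := by
  have h1 := congrArg (fun z => inner ℝ v z) (h.weak_grad φ hφ)
  simp only [inner_neg_right] at h1
  rw [← integral_inner (h.locL2_fun.integrable_smul_gradient hφ),
    ← integral_inner (h.locL2_grad.integrable_smul_test hφ.continuous hφ.2)] at h1
  simpa only [real_inner_smul_right, real_inner_gradient_right, real_inner_comm v] using h1

/-- A weak gradient may be verified one direction at a time. -/
theorem memH1loc_of_integral_mul_fderiv (hu : LocL2 u) (hg : LocL2 g)
    (h : ∀ φ : E N → ℝ, IsTestFun φ → ∀ v : E N,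
      ∫ x, u x * fderiv ℝ φ x v = -∫ x, φ x * inner ℝ (g x) v) : MemH1loc u g := by
  refine ⟨hu, hg, fun φ hφ => ext_inner_left ℝ fun v => ?_⟩
  rw [inner_neg_right, ← integral_inner (hu.integrable_smul_gradient hφ),
    ← integral_inner (hg.integrable_smul_test hφ.continuous hφ.2)]
  simpa only [real_inner_smul_right, real_inner_gradient_right, real_inner_comm v] using h φ hφ v

theorem ContDiff.memH1loc (hu : ContDiff ℝ ∞ u) : MemH1loc u (gradient u) := by
  refine memH1loc_of_integral_mul_fderiv hu.continuous.locL2 hu.continuous_gradient.locL2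
    fun φ hφ v => ?_
  rw [hφ.integral_mul_fderiv hu v]
  simp only [inner_gradient_left, mul_comm]

theorem gradient_inner_left (e : E N) : gradient (fun x => inner ℝ e x) = fun _ => e := by
  ext1 x
  refine ext_inner_right ℝ fun v => ?_
  rw [inner_gradient_left]
  exact DFunLike.congr_fun (innerSL ℝ e).fderiv v

theorem memH1loc_inner (e : E N) : MemH1loc (fun x => inner ℝ e x) (fun _ => e) := by
  have h := (contDiff_const.inner ℝ contDiff_id : ContDiff ℝ ∞ fun x : E N => inner ℝ e x).memH1loc
  rwa [gradient_inner_left] at h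

theorem memH1loc_const (c : ℝ) : MemH1loc (fun _ : E N => c) (fun _ => 0) := by
  have h := (contDiff_const : ContDiff ℝ ∞ fun _ : E N => c).memH1loc
  rwa [show gradient (fun _ : E N => c) = fun _ => 0 from funext fun x => gradient_fun_const x c]
    at h

theorem MemH1loc.congr_ae (h : MemH1loc u g) (hu : u =ᵐ[volume] u') (hg : g =ᵐ[volume] g') :
    MemH1loc u' g' := by
  refine ⟨h.locL2_fun.congr_ae hu, h.locL2_grad.congr_ae hg, fun φ hφ => ?_⟩
  have h1 : ∫ x, u' x • gradient φ x = ∫ x, u x • gradient φ x :=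
    integral_congr_ae (hu.mono fun x hx => by simp only [hx])
  have h2 : ∫ x, φ x • g' x = ∫ x, φ x • g x :=
    integral_congr_ae (hg.mono fun x hx => by simp only [hx])
  rw [h1, h2, h.weak_grad φ hφ]

theorem MemH1loc.sub (h : MemH1loc u g) (h' : MemH1loc u' g') :
    MemH1loc (fun x => u x - u' x) (fun x => g x - g' x) := by
  refine ⟨h.locL2_fun.sub h'.locL2_fun, h.locL2_grad.sub h'.locL2_grad, fun φ hφ => ?_⟩
  simp only [sub_smul, smul_sub]
  rw [integral_sub (h.locL2_fun.integrable_smul_gradient hφ)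
      (h'.locL2_fun.integrable_smul_gradient hφ),
    integral_sub (h.locL2_grad.integrable_smul_test hφ.continuous hφ.2)
      (h'.locL2_grad.integrable_smul_test hφ.continuous hφ.2), h.weak_grad φ hφ,
    h'.weak_grad φ hφ]
  abel

/-- The blow-up `x ↦ s⁻¹ u (s x + b)` has the unscaled weak gradient `g (s x + b)`. -/
theorem MemH1loc.comp_affine (h : MemH1loc u g) {s : ℝ} (hs : s ≠ 0) (b : E N) :
    MemH1loc (fun x => s⁻¹ * u (s • x + b)) (fun x => g (s • x + b)) := by
  refine ⟨(h.locL2_fun.comp_affine hs b).const_smul s⁻¹, h.locL2_grad.comp_affine hs b,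
    fun φ hφ => ?_⟩
  have hψ := hφ.comp_affine (inv_ne_zero hs) (-(s⁻¹ • b))
  have hinv : ∀ x : E N, s⁻¹ • (s • x + b) + -(s⁻¹ • b) = x := fun x => by
    rw [smul_add, smul_smul, inv_mul_cancel₀ hs, one_smul]; abel
  have h1 := h.weak_grad _ hψ
  have h2 := integral_comp_affine
    (fun y => u y • gradient (fun y => φ (s⁻¹ • y + -(s⁻¹ • b))) y) s b
  have h3 := integral_comp_affine (fun y => φ (s⁻¹ • y + -(s⁻¹ • b)) • g y) s b
  rw [h1, smul_neg, ← h3] at h2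
  simp only [gradient_comp_affine hφ.differentiable, hinv] at h2
  rw [← h2]
  exact integral_congr_ae (Filter.Eventually.of_forall fun x => by
    simp only [smul_smul]; rw [mul_comm])

/-- Weak gradients are local. -/
theorem MemH1loc.grad_eq_zero_of_isOpen (h : MemH1loc u g) {U : Set (E N)} (hU : IsOpen U)
    (hu : ∀ᵐ x, x ∈ U → u x = 0) : ∀ᵐ x, x ∈ U → g x = 0 := by
  refine hU.ae_eq_zero_of_integral_contDiff_smul_eq_zero
    (h.locL2_grad.locallyIntegrable.locallyIntegrableOn U) fun φ h1 h2 h3 => ?_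
  have hφ : IsTestFun φ := ⟨h1, h2⟩
  rw [← neg_eq_zero, ← h.weak_grad φ hφ]
  refine integral_eq_zero_of_ae (hu.mono fun x hx => ?_)
  by_cases hxU : x ∈ U
  · simp [hx hxU]
  · have hx' : x ∉ tsupport (fderiv ℝ φ) := fun hh => hxU (h3 (tsupport_fderiv_subset ℝ hh))
    simp [gradient, image_eq_zero_of_notMem_tsupport hx']

theorem MemH1loc.grad_periodic (h : MemH1loc u g) {t : E N} (ht : ∀ᵐ x, u (x + t) = u x) :
    ∀ᵐ x, g (x + t) = g x := by
  have h1 := (h.comp_affine one_ne_zero t).sub h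
  simp only [one_smul, inv_one, one_mul] at h1
  have h2 := h1.grad_eq_zero_of_isOpen isOpen_univ (ht.mono fun x hx _ => by rw [hx, sub_self])
  exact h2.mono fun x hx => sub_eq_zero.1 (hx (mem_univ x))

end WeakGradient

/-! ### Testing a compactly supported divergence-free field against weak gradients -/

section Mollification

variable {N : ℕ} {u : E N → ℝ} {g : E N → E N}

/-- Mollification `U = u * ρ` is smooth, and `∇U = g * ρ` for the weak gradient `g` of `u`. -/
theorem MemH1loc.exists_mollification (h : MemH1loc u g) {ρ : E N → ℝ} (hρ : IsTestFun ρ) :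
    ∃ U : E N → ℝ, ContDiff ℝ ∞ U ∧
      ∀ x v, fderiv ℝ U x v = ∫ t, ρ t * inner ℝ (g (x - t)) v := by
  have hu := h.locL2_fun.locallyIntegrable
  refine ⟨convolution u ρ (ContinuousLinearMap.mul ℝ ℝ) volume,
    hρ.2.contDiff_convolution_right (n := ⊤) _ hu hρ.1, fun x v => ?_⟩
  have hρ1 : ContDiff ℝ 1 ρ := hρ.1.of_le (by simp)
  rw [(hρ.2.hasFDerivAt_convolution_right _ hu hρ1 x).fderiv,
    convolution_precompR_apply _ hu (hρ.2.fderiv ℝ) (hρ1.continuous_fderiv (by simp)),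
    convolution_def]
  have hψ : IsTestFun fun t : E N => ρ ((-1 : ℝ) • t + x) := hρ.comp_affine (by norm_num) x
  have h1 := h.integral_mul_fderiv hψ v
  have h2 : ∀ t, fderiv ℝ (fun t : E N => ρ ((-1 : ℝ) • t + x)) t v = - fderiv ℝ ρ (x - t) v := by
    intro t
    rw [← inner_gradient_left, gradient_comp_affine hρ.differentiable, real_inner_smul_left,
      inner_gradient_left, show (-1 : ℝ) • t + x = x - t by rw [neg_one_smul]; abel]
    ring
  simp only [h2, mul_neg, integral_neg, neg_inj] at h1
  simp only [ContinuousLinearMap.mul_apply']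
  rw [h1, ← integral_sub_left_eq_self _ volume x]
  refine integral_congr_ae (Filter.Eventually.of_forall fun t => ?_)
  simp only
  rw [show (-1 : ℝ) • (x - t) + x = t by rw [neg_one_smul]; abel]

/-- The correlation `t ↦ ∫ F(x) · k(x - t) dx` of two square-integrable fields is continuous. -/
theorem continuous_integral_inner_translate {F k : E N → E N} (hF : MemLp F 2 volume)
    (hk : MemLp k 2 volume) : Continuous fun t : E N => ∫ x, inner ℝ (F x) (k (x - t)) := by
  have hgm : ∀ t : E N, MeasurePreserving (fun x : E N => x - t) volume volume := fun t =>
    measurePreserving_sub_right volume t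
  let τ : E N → C(E N, E N) := fun t => ⟨fun x => x - t, by fun_prop⟩
  have hτ : Continuous τ :=
    ContinuousMap.continuous_of_continuous_uncurry _
      (show Continuous fun p : E N × E N => p.2 - p.1 by fun_prop)
  have hc : Continuous fun t : E N =>
      Lp.compMeasurePreserving (τ t) (hgm t) (hk.toLp k) :=
    Continuous.compMeasurePreservingLp continuous_const hτ hgm (by norm_num)
  have h2 := (continuous_const (y := hF.toLp F)).inner (𝕜 := ℝ) hc
  refine h2.congr fun t => ?_
  rw [L2.inner_def]
  refine integral_congr_ae ?_
  have h3 := Lp.coeFn_compMeasurePreserving (hk.toLp k) (hgm t)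
  have h4 := (hgm t).quasiMeasurePreserving.ae_eq_comp hk.coeFn_toLp
  filter_upwards [h3, h4, hF.coeFn_toLp] with x h3 h4 h5
  rw [h5]
  congr 1
  exact h3.trans h4

/-- A square-integrable field supported in the unit ball and annihilating the gradients of test
functions annihilates all weak gradients. The correlation of the field with the weak gradient is
continuous, and it integrates to zero against every mollifier because mollified functions can be
cut off to test functions; so it vanishes at the origin. -/
theorem integral_inner_grad_eq_zero {F : E N → E N} (hF : MemLp F 2 volume)
    (hsupp : ∀ x, x ∉ ball (0 : E N) 1 → F x = 0)
    (hdiv : ∀ φ, IsTestFun φ → ∫ x, inner ℝ (F x) (gradient φ x) = 0)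
    (h : MemH1loc u g) : ∫ x, inner ℝ (F x) (g x) = 0 := by
  set k : E N → E N := indicator (closedBall 0 3) g with hk_def
  have hkm : MemLp k 2 volume :=
    (memLp_indicator_iff_restrict isClosed_closedBall.measurableSet).2
      (h.locL2_grad _ (isCompact_closedBall 0 3))
  set G : E N → ℝ := fun t => ∫ x, inner ℝ (F x) (k (x - t)) with hG_def
  have hG : Continuous G := continuous_integral_inner_translate hF hkm
  -- truncation is invisible for translations of length less than `1`
  have htrunc : ∀ x t : E N, x ∈ ball (0 : E N) 1 → t ∈ ball (0 : E N) 1 →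
      k (x - t) = g (x - t) := by
    intro x t hx ht
    refine indicator_of_mem ?_ _
    rw [mem_ball_zero_iff] at hx ht
    rw [mem_closedBall_zero_iff]
    linarith [norm_sub_le x t]
  have hF1 : Integrable F volume := by
    have : IsFiniteMeasure (volume.restrict (ball (0 : E N) 1)) :=
      ⟨by simpa using measure_ball_lt_top⟩
    have h1 : IntegrableOn F (ball 0 1) volume :=
      (hF.restrict (ball 0 1)).integrable (by norm_num)
    refine (integrableOn_iff_integrable_of_support_subset fun x hx => ?_).1 h1
    by_contra hx'
    exact hx (hsupp x hx')
  have hk1 : Integrable k volume :=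
    (integrable_indicator_iff isClosed_closedBall.measurableSet).2
      (h.locL2_grad.locallyIntegrable.integrableOn_isCompact (isCompact_closedBall 0 3))
  have hzero : ∀ ρ : E N → ℝ, ContDiff ℝ ∞ ρ → HasCompactSupport ρ →
      tsupport ρ ⊆ ball (0 : E N) 1 → ∫ t, ρ t • G t = 0 := by
    intro ρ h1 h2 h3
    have hρ : IsTestFun ρ := ⟨h1, h2⟩
    obtain ⟨U, hU, hU'⟩ := h.exists_mollification hρ
    obtain ⟨C, hC⟩ := hρ.continuous.bounded_above_of_compact_support h2
    have hint : Integrable (Function.uncurry fun t x : E N =>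
        ρ t * inner ℝ (F x) (k (x - t))) (volume.prod volume) := by
      have h4 := Integrable.convolution_integrand (innerSL ℝ) (μ := volume) hF1 hk1.comp_neg
      simp only [neg_sub] at h4
      exact h4.bdd_mul (c := C) (hρ.continuous.comp continuous_fst).aestronglyMeasurable
        (Filter.Eventually.of_forall fun p => hC p.1)
    let η : ContDiffBump (0 : E N) := ⟨2, 3, by norm_num, by norm_num⟩
    have hη : IsTestFun η := ⟨η.contDiff, η.hasCompactSupport⟩
    rw [← hdiv _ (hη.smooth_mul hU)]
    simp only [hG_def, smul_eq_mul, ← integral_const_mul]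
    rw [integral_integral_swap hint]
    refine integral_congr_ae (Filter.Eventually.of_forall fun x => ?_)
    simp only
    by_cases hx : x ∈ ball (0 : E N) 1
    · have hloc : (fun x => U x * η x) =ᶠ[nhds x] U := by
        filter_upwards [isOpen_ball.mem_nhds hx] with y hy
        rw [η.one_of_mem_closedBall, mul_one]
        exact (ball_subset_closedBall.trans (closedBall_subset_closedBall (by norm_num))) hy
      rw [Filter.EventuallyEq.gradient_eq hloc, real_inner_gradient_right, hU']
      refine integral_congr_ae (Filter.Eventually.of_forall fun t => ?_)
      simp only
      by_cases ht : t ∈ ball (0 : E N) 1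
      · rw [htrunc x t hx ht, real_inner_comm]
      · rw [image_eq_zero_of_notMem_tsupport (fun hh => ht (h3 hh))]
        simp
    · simp [hsupp x hx]
  have hae := isOpen_ball.ae_eq_zero_of_integral_contDiff_smul_eq_zero
    (hG.locallyIntegrable.locallyIntegrableOn _) hzero
  have h0 : G 0 = 0 := Measure.eqOn_open_of_ae_eq (μ := volume) (f := G) (g := fun _ => (0 : ℝ))
    ((ae_restrict_iff' isOpen_ball.measurableSet).2 hae) isOpen_ball hG.continuousOn
    continuousOn_const (mem_ball_self one_pos)
  rw [← h0]
  refine integral_congr_ae (Filter.Eventually.of_forall fun x => ?_)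
  simp only [sub_zero]
  by_cases hx : x ∈ ball (0 : E N) 1
  · have := htrunc x 0 hx (mem_ball_self one_pos)
    rw [sub_zero] at this
    rw [this]
  · simp [hsupp x hx]

end Mollification

/-! ### Solutions on the unit ball -/

section Ball

variable {N : ℕ} {α β R m : ℝ} {e : E N} {w u : E N → ℝ} {g h : E N → E N}

theorem measurable_profile (α β R : ℝ) : Measurable (profile α β R : E N → ℝ) :=
  Measurable.ite (measurableSet_lt measurable_norm measurable_const) measurable_const
    measurable_const

theorem measurable_profileExt (α β R m : ℝ) : Measurable (profileExt α β R m : E N → ℝ) :=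
  Measurable.ite (measurableSet_lt measurable_norm measurable_const) (measurable_profile α β R)
    measurable_const

theorem abs_profile_le (α β R : ℝ) (y : E N) : |profile α β R y| ≤ |α| + |β| := by
  unfold profile
  split_ifs <;> linarith [abs_nonneg α, abs_nonneg β]

theorem abs_profileExt_le (α β R m : ℝ) (y : E N) :
    |profileExt α β R m y| ≤ |α| + |β| + |m| := by
  unfold profileExt
  split_ifs
  · linarith [abs_profile_le α β R y, abs_nonneg m]
  · linarith [abs_nonneg α, abs_nonneg β]

theorem IsBallSolution.memH1loc_sub_inner (hw : IsBallSolution α β R m e w g) :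
    MemH1loc (fun y => w y - inner ℝ e y) (fun y => g y - e) :=
  hw.memH1loc.sub (memH1loc_inner e)

theorem IsBallSolution.grad_outside (hw : IsBallSolution α β R m e w g) :
    ∀ᵐ y : E N, 1 ≤ ‖y‖ → g y = e := by
  have h1 := hw.memH1loc_sub_inner.grad_eq_zero_of_isOpen
    (U := (closedBall 0 1)ᶜ) isClosed_closedBall.isOpen_compl (hw.outside.mono fun y hy hyU => by
      simp only [mem_compl_iff, mem_closedBall_zero_iff, not_le] at hyU
      rw [hy hyU.le, sub_self])
  have h2 : ∀ᵐ y : E N, y ∉ sphere (0 : E N) 1 :=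
    measure_eq_zero_iff_ae_notMem.1 (Measure.addHaar_sphere_of_ne_zero volume 0 one_ne_zero)
  filter_upwards [h1, h2] with y h1 h2 hy
  refine sub_eq_zero.1 (h1 ?_)
  simp only [mem_compl_iff, mem_closedBall_zero_iff, not_le]
  refine lt_of_le_of_ne hy fun hh => h2 ?_
  simp [hh.symm]

/-- On the unit ball the flux `a_B g` is indistinguishable from the constant flux `m e` when tested
against weak gradients, without any boundary condition: the flux `a_B g - m e` vanishes outside the
ball and is divergence-free in the whole space. -/
theorem IsBallSolution.integral_flux (hw : IsBallSolution α β R m e w g) (hu : MemH1loc u h) :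
    ∫ y in ball 0 1, profile α β R y * inner ℝ (g y) (h y)
      = m * ∫ y in ball 0 1, inner ℝ e (h y) := by
  set F : E N → E N := fun y => profileExt α β R m y • g y - m • e with hF
  have hag : LocL2 fun y => profileExt α β R m y • g y :=
    hw.memH1loc.locL2_grad.bdd_smul (measurable_profileExt α β R m).aestronglyMeasurable
      (abs_profileExt_le α β R m)
  have hFl : LocL2 F := hag.sub continuous_const.locL2
  have hFi : MemLp (indicator (ball 0 1) F) 2 volume :=
    (memLp_indicator_iff_restrict isOpen_ball.measurableSet).2
      ((hFl _ (isCompact_closedBall 0 1)).mono_measure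
        (Measure.restrict_mono ball_subset_closedBall le_rfl))
  have hae : indicator (ball 0 1) F =ᵐ[volume] F := by
    filter_upwards [hw.grad_outside] with y hy
    by_cases hyb : y ∈ ball (0 : E N) 1
    · rw [indicator_of_mem hyb]
    · rw [indicator_of_notMem hyb]
      rw [mem_ball_zero_iff] at hyb
      simp [hF, profileExt, hyb, hy (not_lt.1 hyb)]
  have hdiv : ∀ φ, IsTestFun φ → ∫ y, inner ℝ (indicator (ball 0 1) F y) (gradient φ y) = 0 := by
    intro φ hφ
    have h1 : ∫ y, inner ℝ (indicator (ball 0 1) F y) (gradient φ y)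
        = ∫ y, (profileExt α β R m y * inner ℝ (g y) (gradient φ y)
          - m * inner ℝ e (gradient φ y)) := by
      refine integral_congr_ae (hae.mono fun y hy => ?_)
      beta_reduce
      rw [hy]
      simp only [hF, inner_sub_left, real_inner_smul_left]
    have h2 := hag.integrable_inner_gradient hφ
    have h3 := (continuous_const (y := e)).locL2.integrable_inner_gradient hφ
    simp only [real_inner_smul_left] at h2
    rw [h1, integral_sub h2 (h3.const_mul m), integral_const_mul,
      hφ.integral_inner_gradient_eq_zero, hw.equation φ hφ]
    simp
  have key := integral_inner_grad_eq_zero hFi (fun y hy => indicator_of_notMem hy F) hdiv hu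
  have h4 : ∫ y, inner ℝ (indicator (ball 0 1) F y) (h y)
      = ∫ y in ball 0 1, (profile α β R y * inner ℝ (g y) (h y) - m * inner ℝ e (h y)) := by
    rw [← integral_indicator isOpen_ball.measurableSet]
    refine integral_congr_ae (Filter.Eventually.of_forall fun y => ?_)
    by_cases hyb : y ∈ ball (0 : E N) 1
    · simp only [indicator_of_mem hyb, hF, inner_sub_left, real_inner_smul_left]
      rw [profileExt, if_pos (mem_ball_zero_iff.1 hyb)]
    · simp [indicator_of_notMem hyb]
  have h5 : IntegrableOn (fun y => profile α β R y * inner ℝ (g y) (h y)) (ball 0 1) := by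
    have := (hw.memH1loc.locL2_grad.bdd_smul (measurable_profile α β R).aestronglyMeasurable
      (abs_profile_le α β R)).integrableOn_inner hu.locL2_grad (isBounded_ball (x := 0) (r := 1))
    simpa only [real_inner_smul_left] using this
  have h6 : IntegrableOn (fun y => inner ℝ e (h y)) (ball 0 1) :=
    continuous_const.locL2.integrableOn_inner hu.locL2_grad isBounded_ball
  rw [h4, integral_sub h5 (h6.const_mul m), integral_const_mul, sub_eq_zero] at key
  exact key

/-- The mean of the gradient over the ball is `e`, by the boundary condition. -/
theorem IsBallSolution.integral_inner_grad (hw : IsBallSolution α β R m e w g) (v : E N) :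
    ∫ y in ball 0 1, inner ℝ v (g y) = ∫ _ in ball (0 : E N) 1, inner ℝ v e := by
  let η : ContDiffBump (0 : E N) := ⟨2, 3, by norm_num, by norm_num⟩
  have hη : IsTestFun η := ⟨η.contDiff, η.hasCompactSupport⟩
  have h1 := hw.memH1loc_sub_inner.integral_mul_fderiv hη v
  have h2 : ∫ y, (w y - inner ℝ e y) * fderiv ℝ η y v = 0 := by
    refine integral_eq_zero_of_ae (hw.outside.mono fun y hy => ?_)
    by_cases hyb : y ∈ ball (0 : E N) 1
    · have hloc : (η : E N → ℝ) =ᶠ[nhds y] fun _ => 1 := by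
        filter_upwards [isOpen_ball.mem_nhds hyb] with z hz
        exact η.one_of_mem_closedBall
          ((ball_subset_closedBall.trans (closedBall_subset_closedBall (by norm_num))) hz)
      simp [hloc.fderiv_eq]
    · rw [mem_ball_zero_iff, not_lt] at hyb
      simp [hy hyb]
  have h3 : ∫ y, η y * inner ℝ (g y - e) v
      = ∫ y in ball 0 1, (inner ℝ v (g y) - inner ℝ v e) := by
    rw [← integral_indicator isOpen_ball.measurableSet]
    refine integral_congr_ae (hw.grad_outside.mono fun y hy => ?_)
    by_cases hyb : y ∈ ball (0 : E N) 1
    · simp only [indicator_of_mem hyb]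
      rw [η.one_of_mem_closedBall
        ((ball_subset_closedBall.trans (closedBall_subset_closedBall (by norm_num))) hyb),
        one_mul, real_inner_comm, inner_sub_right]
    · simp only [indicator_of_notMem hyb]
      rw [mem_ball_zero_iff, not_lt] at hyb
      simp [hy hyb]
  have h4 : IntegrableOn (fun y => inner ℝ v (g y)) (ball 0 1) :=
    continuous_const.locL2.integrableOn_inner hw.memH1loc.locL2_grad isBounded_ball
  have h5 : IntegrableOn (fun _ : E N => inner ℝ v e) (ball 0 1) :=
    integrableOn_const (by simpa using measure_ball_lt_top.ne)
  rw [h2, h3, integral_sub h4 h5, eq_comm, neg_eq_zero, sub_eq_zero] at h1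
  exact h1

/-- Testing the equation for one constant with a solution for the other compares the constants. -/
theorem IsEquivalentTo.unique (hN : 1 ≤ N) {m m' : ℝ} (h : IsEquivalentTo N α β R m)
    (h' : IsEquivalentTo N α β R m') : m' = m := by
  set e : E N := EuclideanSpace.single ⟨0, hN⟩ 1 with he
  obtain ⟨w, g, hw⟩ := h.2 e
  obtain ⟨w', g', hw'⟩ := h'.2 e
  have h1 := hw.integral_flux hw'.memH1loc
  have h2 := hw'.integral_flux hw.memH1loc
  rw [hw'.integral_inner_grad] at h1
  rw [hw.integral_inner_grad] at h2
  simp only [real_inner_comm] at h1 h2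
  rw [h1] at h2
  have h3 : ∫ _ in ball (0 : E N) 1, inner ℝ e e ≠ 0 := by
    have hv : (volume (ball (0 : E N) 1)).toReal ≠ 0 :=
      (ENNReal.toReal_pos (measure_ball_pos volume 0 one_pos).ne' measure_ball_lt_top.ne).ne'
    simpa [he, Measure.real] using hv
  exact (mul_right_cancel₀ h3 h2).symm

theorem setIntegral_ball_eq (f : E N → ℝ) (c : E N) {r : ℝ} (hr : 0 < r) :
    ∫ x in ball c r, f x = r ^ N * ∫ z in ball 0 1, f (r • z + c) := by
  rw [← integral_indicator isOpen_ball.measurableSet,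
    ← integral_indicator isOpen_ball.measurableSet]
  have h := integral_comp_affine (indicator (ball c r) f) r c
  have h2 : ∀ z, indicator (ball c r) f (r • z + c)
      = indicator (ball 0 1) (fun z => f (r • z + c)) z := by
    intro z
    have : r • z + c ∈ ball c r ↔ z ∈ ball (0 : E N) 1 := by
      rw [mem_ball_iff_norm, mem_ball_zero_iff, add_sub_cancel_right, norm_smul, Real.norm_eq_abs,
        abs_of_pos hr]
      exact mul_lt_iff_lt_one_right hr
    by_cases hz : z ∈ ball (0 : E N) 1
    · rw [indicator_of_mem hz, indicator_of_mem (this.2 hz)]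
    · rw [indicator_of_notMem hz, indicator_of_notMem (mt this.1 hz)]
  simp only [h2] at h
  rw [h, abs_of_pos (by positivity), smul_eq_mul, ← mul_assoc, mul_inv_cancel₀ (by positivity),
    one_mul]

theorem IsBallSolution.integral_flux_ball (hw : IsBallSolution α β R m e w g)
    (hu : MemH1loc u h) (c : E N) {r : ℝ} (hr : 0 < r) :
    ∫ x in ball c r, profile α β R (r⁻¹ • (x - c)) * inner ℝ (g (r⁻¹ • (x - c))) (h x)
      = m * ∫ x in ball c r, inner ℝ e (h x) := by
  rw [setIntegral_ball_eq _ c hr, setIntegral_ball_eq _ c hr]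
  have hz : ∀ z : E N, r⁻¹ • (r • z + c - c) = z := fun z => by
    rw [add_sub_cancel_right, smul_smul, inv_mul_cancel₀ hr.ne', one_smul]
  simp only [hz]
  rw [hw.integral_flux (hu.comp_affine hr.ne' c)]
  ring

end Ball

/-! ### Pasting rescaled functions on a periodic family of balls -/

theorem latticePt_neg {N : ℕ} (k : Fin N → ℤ) : latticePt (-k) = -(latticePt k : E N) := by
  ext i; simp [latticePt]

theorem latticePt_add {N : ℕ} (k l : Fin N → ℤ) :
    latticePt (k + l) = (latticePt k + latticePt l : E N) := by
  ext i; simp [latticePt]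

theorem setLIntegral_ball_eq {N : ℕ} (f : E N → ENNReal) (c : E N) {r : ℝ} (hr : 0 < r) :
    ∫⁻ x in ball c r, f (r⁻¹ • (x - c)) = ENNReal.ofReal (r ^ N) * ∫⁻ z in ball 0 1, f z := by
  rw [← lintegral_indicator isOpen_ball.measurableSet,
    ← lintegral_indicator isOpen_ball.measurableSet]
  have hs : r⁻¹ ≠ 0 := inv_ne_zero hr.ne'
  have h := (affineHomeo hs (-(r⁻¹ • c))).measurableEmbedding.lintegral_map (μ := volume)
    (indicator (ball (0 : E N) 1) f)
  rw [show Measure.map (affineHomeo hs (-(r⁻¹ • c))) volume = _ from map_affine_volume hs _,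
    lintegral_smul_measure, inv_pow, inv_inv, abs_of_pos (by positivity), smul_eq_mul] at h
  rw [h]
  refine lintegral_congr fun x => ?_
  have hx : affineHomeo hs (-(r⁻¹ • c)) x = r⁻¹ • (x - c) := by
    rw [affineHomeo_apply, smul_sub, sub_eq_add_neg]
  have : x ∈ ball c r ↔ r⁻¹ • (x - c) ∈ ball (0 : E N) 1 := by
    rw [mem_ball_iff_norm, mem_ball_zero_iff, norm_smul, Real.norm_eq_abs,
      abs_of_pos (inv_pos.2 hr), inv_mul_lt_iff₀ hr, mul_one]
  rw [hx]
  by_cases hxb : x ∈ ball c r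
  · rw [indicator_of_mem hxb, indicator_of_mem (this.1 hxb)]
  · rw [indicator_of_notMem hxb, indicator_of_notMem (mt this.2 hxb)]

namespace IsPeriodicBallCover

variable {N : ℕ} {ι : Type*} {c : ι → E N} {ρ : ι → ℝ} {α β R m : ℝ} {e : E N}
  {w u : E N → ℝ} {g h : E N → E N}

theorem eq_of_mem (hc : IsPeriodicBallCover c ρ) {x : E N} {p q : ι}
    (hp : x ∈ ball (c p) (ρ p)) (hq : x ∈ ball (c q) (ρ q)) : p = q := by
  by_contra hne
  exact Set.disjoint_left.1 (hc.disjoint hne) hp hq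

theorem exists_translate_mem (hc : IsPeriodicBallCover c ρ) (k : Fin N → ℤ) {x : E N} {p : ι}
    (hx : x ∈ ball (c p) (ρ p)) :
    ∃ q, c q = c p + latticePt k ∧ ρ q = ρ p ∧ x + latticePt k ∈ ball (c q) (ρ q) := by
  obtain ⟨q, hq, hq'⟩ := hc.translate k p
  refine ⟨q, hq, hq', ?_⟩
  rw [hq, hq', mem_ball_iff_norm, add_sub_add_right_eq_sub]
  exact mem_ball_iff_norm.1 hx

theorem paste_add_latticePt (hc : IsPeriodicBallCover c ρ) {V : Type*} [Zero V]
    {F : ι → E N → V} (hF : ∀ p q, ρ p = ρ q → F p = F q) (k : Fin N → ℤ) (x : E N) :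
    paste c ρ F (x + latticePt k) = paste c ρ F x := by
  by_cases h : ∃ p, x ∈ ball (c p) (ρ p)
  · obtain ⟨p, hp⟩ := h
    obtain ⟨q, hq, hq', hx⟩ := hc.exists_translate_mem k hp
    rw [paste_eq hc F hp, paste_eq hc F hx, hq, hq', hF q p hq', add_sub_add_right_eq_sub]
  · have h' : ¬∃ p, x + latticePt k ∈ ball (c p) (ρ p) := by
      rintro ⟨p, hp⟩
      obtain ⟨q, -, -, hx⟩ := hc.exists_translate_mem (-k) hp
      rw [latticePt_neg, add_neg_cancel_right] at hx
      exact h ⟨q, hx⟩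
    rw [paste, paste, dif_neg h, dif_neg h']

/-- The radii are bounded, since a ball is disjoint from its translate by a unit vector. -/
theorem radius_le_one (hc : IsPeriodicBallCover c ρ) (hN : 1 ≤ N) (p : ι) : ρ p ≤ 1 := by
  by_contra! h
  set k : Fin N → ℤ := Pi.single ⟨0, hN⟩ 1 with hk
  have hk' : (latticePt k : E N) = EuclideanSpace.single ⟨0, hN⟩ 1 := by
    ext i
    by_cases hi : i = ⟨0, hN⟩
    · subst hi; simp [latticePt, hk]
    · simp [latticePt, hk, hi]
  obtain ⟨q, hq, hq'⟩ := hc.translate k p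
  have hnorm : ‖(latticePt k : E N)‖ = 1 := by rw [hk']; simp
  have hpq : p = q := by
    refine hc.eq_of_mem (x := c q) ?_ (mem_ball_self (hc.radius_pos q))
    rw [hq, mem_ball_iff_norm, add_sub_cancel_left, hnorm]
    exact h
  rw [← hpq, left_eq_add] at hq
  rw [hq] at hnorm
  simp at hnorm

theorem ae_exists_mem (hc : IsPeriodicBallCover c ρ) :
    ∀ᵐ x : E N, x ∈ ⋃ p, ball (c p) (ρ p) :=
  hc.covers

theorem abs_hsCoeff_le (hc : IsPeriodicBallCover c ρ) (α β R : ℝ) (x : E N) :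
    |hsCoeff α β R c ρ x| ≤ |α| + |β| := by
  by_cases h : ∃ p, x ∈ ball (c p) (ρ p)
  · obtain ⟨p, hp⟩ := h
    rw [hsCoeff, paste_eq hc _ hp]
    exact abs_profile_le α β R _
  · rw [hsCoeff, paste, dif_neg h, abs_zero]
    positivity

/-- On each ball of the family the flux is indistinguishable from the constant flux `m e`. -/
theorem integral_flux_ball (hc : IsPeriodicBallCover c ρ) (hw : IsBallSolution α β R m e w g)
    (hu : MemH1loc u h) (p : ι) :
    ∫ x in ball (c p) (ρ p),
        hsCoeff α β R c ρ x * inner ℝ (hsCorrectorGrad c ρ e g x + e) (h x)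
      = m * ∫ x in ball (c p) (ρ p), inner ℝ e (h x) := by
  rw [← hw.integral_flux_ball hu (c p) (hc.radius_pos p)]
  refine setIntegral_congr_fun isOpen_ball.measurableSet fun x hx => ?_
  simp only [hsCoeff, hsCorrectorGrad]
  rw [paste_eq hc _ hx, paste_eq hc _ hx, sub_add_cancel]

variable [Countable ι]

/-- An integral over the whole space vanishes if the integral over each ball does. -/
theorem integral_eq_zero (hc : IsPeriodicBallCover c ρ) {f : E N → ℝ} (hf : Integrable f)
    (h : ∀ p, ∫ x in ball (c p) (ρ p), f x = 0) : ∫ x, f x = 0 := by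
  rw [← Measure.restrict_eq_self_of_ae_mem hc.ae_exists_mem,
    integral_iUnion (fun p => isOpen_ball.measurableSet) hc.disjoint hf.integrableOn]
  simp [h]

theorem aestronglyMeasurable_paste (hc : IsPeriodicBallCover c ρ) {V : Type*}
    [NormedAddCommGroup V] {F : ι → E N → V} (hF : ∀ p, LocL2 (F p)) :
    AEStronglyMeasurable (paste c ρ F) volume := by
  rw [← Measure.restrict_eq_self_of_ae_mem hc.ae_exists_mem, aestronglyMeasurable_iUnion_iff]
  intro p
  have h := ((hF p).comp_affine (inv_ne_zero (hc.radius_pos p).ne')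
    (-((ρ p)⁻¹ • c p))).aestronglyMeasurable.restrict (s := ball (c p) (ρ p))
  refine h.congr ((ae_restrict_iff' isOpen_ball.measurableSet).2
    (Filter.Eventually.of_forall fun x hx => ?_))
  rw [paste_eq hc F hx, smul_sub, sub_eq_add_neg]

/-- Pasting preserves local square-integrability: the squared norm over a ball is at most a fixed
multiple of the volume of the ball, and the balls meeting a bounded set stay in a bounded set. -/
theorem locL2_paste (hc : IsPeriodicBallCover c ρ) (hN : 1 ≤ N) {V : Type*}
    [NormedAddCommGroup V] {F : ι → E N → V} {W : E N → V} (hF : ∀ p, LocL2 (F p))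
    (hW : LocL2 W) (hFW : ∀ p z, ‖F p z‖ₑ ≤ ‖W z‖ₑ) : LocL2 (paste c ρ F) := by
  intro K hK
  refine ⟨(hc.aestronglyMeasurable_paste hF).restrict, ?_⟩
  rw [eLpNorm_lt_top_iff_lintegral_rpow_enorm_lt_top (by norm_num) (by norm_num)]
  have h2 : (2 : ENNReal).toReal = 2 := by norm_num
  rw [h2]
  set I : ENNReal := ∫⁻ z in ball (0 : E N) 1, ‖W z‖ₑ ^ (2 : ℝ) with hI
  have hI' : I < ⊤ := by
    have h := (hW _ (isCompact_closedBall 0 1)).mono_measure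
      (Measure.restrict_mono (ball_subset_closedBall (x := (0 : E N)) (ε := 1)) le_rfl)
    have h' := h.2
    rwa [eLpNorm_lt_top_iff_lintegral_rpow_enorm_lt_top (by norm_num) (by norm_num), h2] at h'
  set B : ENNReal := volume (ball (0 : E N) 1) with hB
  have hB0 : B ≠ 0 := (measure_ball_pos volume 0 one_pos).ne'
  have hBt : B ≠ ⊤ := measure_ball_lt_top.ne
  have hball : ∀ p, ∫⁻ x in ball (c p) (ρ p), ‖paste c ρ F x‖ₑ ^ (2 : ℝ)
      ≤ I / B * volume (ball (c p) (ρ p)) := by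
    intro p
    calc ∫⁻ x in ball (c p) (ρ p), ‖paste c ρ F x‖ₑ ^ (2 : ℝ)
        ≤ ∫⁻ x in ball (c p) (ρ p), ‖W ((ρ p)⁻¹ • (x - c p))‖ₑ ^ (2 : ℝ) := by
          refine setLIntegral_mono' isOpen_ball.measurableSet fun x hx => ?_
          rw [paste_eq hc F hx]
          exact ENNReal.rpow_le_rpow (hFW _ _) (by norm_num)
      _ = ENNReal.ofReal (ρ p ^ N) * I :=
          setLIntegral_ball_eq (fun z => ‖W z‖ₑ ^ (2 : ℝ)) (c p) (hc.radius_pos p)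
      _ = I / B * volume (ball (c p) (ρ p)) := by
          rw [Measure.addHaar_ball_of_pos volume _ (hc.radius_pos p), ← hB,
            finrank_euclideanSpace_fin, mul_left_comm, ENNReal.div_mul_cancel hB0 hBt]
  obtain ⟨r, hr⟩ := hK.isBounded.subset_ball (0 : E N)
  -- a ball meeting `K` lies in `ball 0 (r + 2)`, its diameter being at most `2`
  have hpiece : ∀ p, ∫⁻ x in K ∩ ball (c p) (ρ p), ‖paste c ρ F x‖ₑ ^ (2 : ℝ)
      ≤ I / B * volume (ball (c p) (ρ p) ∩ ball 0 (r + 2)) := by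
    intro p
    by_cases hp : (K ∩ ball (c p) (ρ p)).Nonempty
    · obtain ⟨y, hyK, hyp⟩ := hp
      have hsub : ball (c p) (ρ p) ⊆ ball 0 (r + 2) := by
        intro z hz
        have h1 := hr hyK
        rw [mem_ball_zero_iff] at h1 ⊢
        rw [mem_ball_iff_norm] at hyp hz
        have h3 := hc.radius_le_one hN p
        calc ‖z‖ = ‖(z - c p) - (y - c p) + y‖ := by congr 1; abel
          _ ≤ ‖(z - c p) - (y - c p)‖ + ‖y‖ := norm_add_le _ _
          _ ≤ ‖z - c p‖ + ‖y - c p‖ + ‖y‖ := by gcongr; exact norm_sub_le _ _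
          _ < r + 2 := by linarith
      rw [inter_eq_left.2 hsub]
      exact (lintegral_mono_set inter_subset_right).trans (hball p)
    · rw [not_nonempty_iff_eq_empty.1 hp]
      simp
  calc ∫⁻ x in K, ‖paste c ρ F x‖ₑ ^ (2 : ℝ)
      = ∫⁻ x in ⋃ p, K ∩ ball (c p) (ρ p), ‖paste c ρ F x‖ₑ ^ (2 : ℝ) := by
        rw [← inter_iUnion, ← Measure.restrict_restrict hK.measurableSet,
          Measure.restrict_eq_self_of_ae_mem hc.ae_exists_mem]
    _ ≤ ∑' p, ∫⁻ x in K ∩ ball (c p) (ρ p), ‖paste c ρ F x‖ₑ ^ (2 : ℝ) :=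
        lintegral_iUnion_le _ _
    _ ≤ ∑' p, I / B * volume (ball (c p) (ρ p) ∩ ball 0 (r + 2)) := ENNReal.tsum_le_tsum hpiece
    _ = I / B * volume (⋃ p, ball (c p) (ρ p) ∩ ball 0 (r + 2)) := by
        rw [ENNReal.tsum_mul_left, measure_iUnion]
        · intro p q hpq
          exact (hc.disjoint hpq).mono inter_subset_left inter_subset_left
        · exact fun p => (isOpen_ball.inter isOpen_ball).measurableSet
    _ ≤ I / B * volume (ball (0 : E N) (r + 2)) := by
        gcongr
        exact iUnion_subset fun p => inter_subset_right
    _ < ⊤ := ENNReal.mul_lt_top (ENNReal.div_lt_top hI'.ne hB0) measure_ball_lt_top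

/-- Rescaled copies of an `H¹` function vanishing outside the unit ball paste to an `H¹_loc`
function, since each copy, extended by zero, has its weak gradient in the whole space. -/
theorem memH1loc_paste (hc : IsPeriodicBallCover c ρ) (hN : 1 ≤ N) {v : E N → ℝ}
    {γ : E N → E N} (h : MemH1loc v γ) (hv : ∀ᵐ y : E N, 1 ≤ ‖y‖ → v y = 0)
    (hγ : ∀ᵐ y : E N, 1 ≤ ‖y‖ → γ y = 0) :
    MemH1loc (paste c ρ fun p z => ρ p * v z) (paste c ρ fun _ z => γ z) := by
  have h1 : LocL2 (paste c ρ fun p z => ρ p * v z) :=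
    hc.locL2_paste hN (fun p => h.locL2_fun.const_smul (ρ p)) h.locL2_fun fun p z => by
      rw [enorm_mul]
      refine mul_le_of_le_one_left' ?_
      rw [← ofReal_norm, Real.norm_eq_abs, abs_of_pos (hc.radius_pos p)]
      exact ENNReal.ofReal_le_one.2 (hc.radius_le_one hN p)
  have h2 : LocL2 (paste c ρ fun _ z => γ z) :=
    hc.locL2_paste hN (fun _ => h.locL2_grad) h.locL2_grad fun _ _ => le_rfl
  refine memH1loc_of_integral_mul_fderiv h1 h2 fun φ hφ d => ?_
  have hint : ∀ {a : E N → ℝ} {b : E N → E N}, LocL2 a → LocL2 b →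
      Integrable (fun x => a x * fderiv ℝ φ x d) ∧ Integrable fun x => φ x * inner ℝ (b x) d := by
    intro a b ha hb
    constructor
    · exact ha.locallyIntegrable.integrable_smul_right_of_hasCompactSupport
        (hφ.fderiv_apply d).continuous (hφ.fderiv_apply d).2
    · have := (hb.integrable_smul_test hφ.continuous hφ.2).inner_const (𝕜 := ℝ) d
      simpa only [real_inner_smul_left] using this
  obtain ⟨i1, i2⟩ := hint h1 h2
  rw [eq_neg_iff_add_eq_zero, ← integral_add i1 i2]
  refine hc.integral_eq_zero (i1.add i2) fun p => ?_
  have hs : (ρ p)⁻¹ ≠ 0 := inv_ne_zero (hc.radius_pos p).ne'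
  have hp := h.comp_affine hs (-((ρ p)⁻¹ • c p))
  have e1 := hp.integral_mul_fderiv hφ d
  obtain ⟨i3, i4⟩ := hint hp.locL2_fun hp.locL2_grad
  rw [eq_neg_iff_add_eq_zero, ← integral_add i3 i4] at e1
  rw [← e1, ← integral_indicator isOpen_ball.measurableSet]
  refine integral_congr_ae ?_
  filter_upwards [ae_comp_affine hv hs (-((ρ p)⁻¹ • c p)),
    ae_comp_affine hγ hs (-((ρ p)⁻¹ • c p))] with x hx hx'
  have hxe : (ρ p)⁻¹ • x + -((ρ p)⁻¹ • c p) = (ρ p)⁻¹ • (x - c p) := by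
    rw [smul_sub, sub_eq_add_neg]
  rw [hxe] at hx hx' ⊢
  by_cases hxb : x ∈ ball (c p) (ρ p)
  · rw [indicator_of_mem hxb, paste_eq hc _ hxb, paste_eq hc _ hxb, inv_inv]
  · have hn : 1 ≤ ‖(ρ p)⁻¹ • (x - c p)‖ := by
      rw [mem_ball_iff_norm, not_lt] at hxb
      rw [norm_smul, Real.norm_eq_abs, abs_of_pos (inv_pos.2 (hc.radius_pos p)),
        ← div_eq_inv_mul, one_le_div (hc.radius_pos p)]
      exact hxb
    rw [indicator_of_notMem hxb, hx hn, hx' hn]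
    simp

theorem aestronglyMeasurable_hsCoeff (hc : IsPeriodicBallCover c ρ) (α β R : ℝ) :
    AEStronglyMeasurable (hsCoeff α β R c ρ) volume := by
  refine hc.aestronglyMeasurable_paste fun _ K hK => ?_
  have : IsFiniteMeasure (volume.restrict K) := ⟨by simpa using hK.measure_lt_top⟩
  exact MemLp.of_bound (measurable_profile α β R).aestronglyMeasurable _
    (Filter.Eventually.of_forall (abs_profile_le α β R))

theorem memH1loc_hsCorrector (hc : IsPeriodicBallCover c ρ) (hN : 1 ≤ N)
    (hw : IsBallSolution α β R m e w g) :
    MemH1loc (hsCorrector c ρ e w) (hsCorrectorGrad c ρ e g) :=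
  hc.memH1loc_paste hN hw.memH1loc_sub_inner
    (hw.outside.mono fun y hy hy' => by rw [hy hy', sub_self])
    (hw.grad_outside.mono fun y hy hy' => by rw [hy hy', sub_self])

theorem locL2_flux (hc : IsPeriodicBallCover c ρ) (hg : LocL2 g) (e : E N) (α β R : ℝ) :
    LocL2 fun x => hsCoeff α β R c ρ x • (g x + e) :=
  (hg.add continuous_const.locL2).bdd_smul (hc.aestronglyMeasurable_hsCoeff α β R)
    (hc.abs_hsCoeff_le α β R)

theorem isDivFree_flux (hc : IsPeriodicBallCover c ρ) (hN : 1 ≤ N)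
    (hw : IsBallSolution α β R m e w g) :
    IsDivFree (hsCoeff α β R c ρ) (fun x => hsCorrectorGrad c ρ e g x + e) := by
  intro φ hφ
  have h1 := (hc.locL2_flux (hc.memH1loc_hsCorrector hN hw).locL2_grad e α β
    R).integrable_inner_gradient hφ
  simp only [real_inner_smul_left] at h1
  have h2 := ((continuous_const (y := e)).locL2.integrable_inner_gradient hφ).const_mul m
  have h3 := hc.integral_eq_zero (h1.sub h2) fun p => by
    simp only [Pi.sub_apply]
    rw [integral_sub h1.integrableOn h2.integrableOn, hc.integral_flux_ball hw hφ.1.memH1loc p,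
      integral_const_mul, sub_self]
  simp only [Pi.sub_apply] at h3
  rwa [integral_sub h1 h2, integral_const_mul, hφ.integral_inner_gradient_eq_zero, mul_zero,
    sub_zero] at h3

end IsPeriodicBallCover

/-! ### Periodic functions and fundamental domains -/

section Periodic

open scoped Pointwise

variable {N : ℕ}

/-- The lattice `ℤ^N` in `ℝ^N`. -/
abbrev intLattice (N : ℕ) : AddSubgroup (E N) :=
  (Submodule.span ℤ (range (EuclideanSpace.basisFun (Fin N) ℝ).toBasis)).toAddSubgroup

theorem mem_intLattice {x : E N} : x ∈ intLattice N ↔ ∃ k, latticePt k = x := by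
  rw [Submodule.mem_toAddSubgroup, Module.Basis.mem_span_iff_repr_mem]
  constructor
  · intro h
    choose k hk using h
    refine ⟨k, ?_⟩
    ext i
    simpa [latticePt] using hk i
  · rintro ⟨k, rfl⟩ i
    exact ⟨k i, by simp [latticePt]⟩

instance countable_intLattice : Countable (intLattice N) :=
  Function.Surjective.countable
    (f := fun k : Fin N → ℤ => (⟨latticePt k, mem_intLattice.2 ⟨k, rfl⟩⟩ : intLattice N))
    fun l => (mem_intLattice.1 l.2).imp fun _ hk => Subtype.ext hk

theorem unitCell_eq_preimage : unitCell N = WithLp.ofLp ⁻¹' Icc (0 : Fin N → ℝ) 1 := by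
  ext x
  simp [unitCell, Pi.le_def, forall_and]

theorem volume_unitCell : volume (unitCell N) = 1 := by
  rw [unitCell_eq_preimage, (PiLp.volume_preserving_ofLp (Fin N)).measure_preimage
    measurableSet_Icc.nullMeasurableSet, Real.volume_Icc_pi]
  simp

theorem isCompact_unitCell : IsCompact (unitCell N) := by
  rw [unitCell_eq_preimage]
  exact (PiLp.homeomorph 2 fun _ : Fin N => ℝ).isClosedEmbedding.isCompact_preimage isCompact_Icc

theorem isAddFundamentalDomain_unitCell :
    IsAddFundamentalDomain (intLattice N) (unitCell N) volume := by
  have h := ZSpan.isAddFundamentalDomain' (EuclideanSpace.basisFun (Fin N) ℝ).toBasis volume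
  have h1 : ZSpan.fundamentalDomain (EuclideanSpace.basisFun (Fin N) ℝ).toBasis
      = WithLp.ofLp ⁻¹' (univ.pi fun i => Ico ((0 : Fin N → ℝ) i) ((1 : Fin N → ℝ) i)) := by
    ext x
    simp [ZSpan.mem_fundamentalDomain]
  have h2 := (PiLp.volume_preserving_ofLp (Fin N)).quasiMeasurePreserving.preimage_ae_eq
    (Measure.univ_pi_Ico_ae_eq_Icc (μ := fun _ : Fin N => (volume : Measure ℝ))
      (f := (0 : Fin N → ℝ)) (g := 1))
  rw [← h1, ← unitCell_eq_preimage] at h2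
  refine ⟨isCompact_unitCell.measurableSet.nullMeasurableSet, ?_, fun l l' hl => ?_⟩
  · filter_upwards [h.ae_covers] with x ⟨l, hl⟩
    rw [h1] at hl
    refine ⟨l, fun i => ?_⟩
    have hi := hl i (mem_univ i)
    exact ⟨hi.1, hi.2.le⟩
  · exact (h.aedisjoint hl).congr ((vadd_set_ae_eq l).2 h2.symm) ((vadd_set_ae_eq l').2 h2.symm)

/-- A function that is periodic almost everywhere agrees almost everywhere with a periodic one. -/
theorem exists_periodic_ae_eq {f : E N → ℝ}
    (hf : ∀ k : Fin N → ℤ, ∀ᵐ x, f (x + latticePt k) = f x) :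
    ∃ f' : E N → ℝ, f' =ᵐ[volume] f ∧ ∀ (l : intLattice N) (x : E N), f' (l +ᵥ x) = f' x := by
  -- the set where `f` is periodic is invariant and of full measure; `f` is replaced by `0` off it
  set S : Set (E N) := {x | ∀ k : Fin N → ℤ, f (x + latticePt k) = f x}
  have hadd : ∀ (x : E N) (k : Fin N → ℤ), x ∈ S → x + latticePt k ∈ S := by
    intro x k hx l
    rw [add_assoc, ← latticePt_add, hx, hx]
  refine ⟨indicator S f, ?_, ?_⟩
  · filter_upwards [ae_all_iff.2 hf] with x hx
    exact indicator_of_mem (s := S) hx f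
  · rintro ⟨l, hl⟩ x
    obtain ⟨k, rfl⟩ := mem_intLattice.1 hl
    rw [AddSubgroup.mk_vadd, vadd_eq_add, add_comm]
    by_cases hx : x ∈ S
    · rw [indicator_of_mem (hadd x k hx), indicator_of_mem hx, hx k]
    · have hx' : x + latticePt k ∉ S := fun h => hx (by
        simpa [latticePt_neg] using hadd _ (-k) h)
      rw [indicator_of_notMem hx, indicator_of_notMem hx']

theorem setIntegral_eq_of_ae_periodic {f : E N → ℝ}
    (hf : ∀ k : Fin N → ℤ, ∀ᵐ x, f (x + latticePt k) = f x) {D D' : Set (E N)}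
    (hD : IsAddFundamentalDomain (intLattice N) D volume)
    (hD' : IsAddFundamentalDomain (intLattice N) D' volume) :
    ∫ x in D, f x = ∫ x in D', f x := by
  obtain ⟨f', h1, h2⟩ := exists_periodic_ae_eq hf
  rw [← integral_congr_ae (ae_restrict_of_ae h1), ← integral_congr_ae (ae_restrict_of_ae h1)]
  exact hD.setIntegral_eq hD' h2

theorem integrableOn_of_ae_periodic {f : E N → ℝ}
    (hf : ∀ k : Fin N → ℤ, ∀ᵐ x, f (x + latticePt k) = f x) {D D' : Set (E N)}
    (hD : IsAddFundamentalDomain (intLattice N) D volume)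
    (hD' : IsAddFundamentalDomain (intLattice N) D' volume) (h : IntegrableOn f D volume) :
    IntegrableOn f D' volume := by
  obtain ⟨f', h1, h2⟩ := exists_periodic_ae_eq hf
  have h3 : IntegrableOn f' D volume := h.congr_fun_ae (ae_restrict_of_ae h1.symm)
  exact ((hD.integrableOn_iff hD' h2).1 h3).congr_fun_ae (ae_restrict_of_ae h1)

/-- The integral of a periodic function over the unit cell is invariant under translation. -/
theorem setIntegral_unitCell_sub {f : E N → ℝ}
    (hf : ∀ k : Fin N → ℤ, ∀ᵐ x, f (x + latticePt k) = f x) (t : E N) :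
    ∫ x in unitCell N, f (x - t) = ∫ x in unitCell N, f x := by
  have hD := (isAddFundamentalDomain_unitCell (N := N)).vadd_of_comm (G' := E N) (-t)
  rw [setIntegral_eq_of_ae_periodic hf isAddFundamentalDomain_unitCell hD]
  have h := (measurePreserving_sub_right (volume : Measure (E N)) t).setIntegral_preimage_emb
    (MeasurableEquiv.subRight t).measurableEmbedding f (-t +ᵥ unitCell N)
  rw [← h]
  congr 2
  ext x
  simp [mem_vadd_set_iff_neg_vadd_mem]

/-- Averaging a periodic function over translations with weight `ρ` multiplies its integral over the
unit cell by `∫ ρ`. -/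
theorem setIntegral_unitCell_average {f ρ : E N → ℝ} (hf : LocallyIntegrable f volume)
    (hper : ∀ k : Fin N → ℤ, ∀ᵐ x, f (x + latticePt k) = f x) (hρ : Continuous ρ)
    (hρs : HasCompactSupport ρ) :
    ∫ x in unitCell N, ∫ t, ρ t * f (x - t) = (∫ t, ρ t) * ∫ x in unitCell N, f x := by
  obtain ⟨r, hr⟩ := hρs.isCompact.isBounded.subset_closedBall (0 : E N)
  obtain ⟨M, hM⟩ := (isCompact_unitCell (N := N)).isBounded.subset_closedBall (0 : E N)
  have hK : IsCompact (closedBall (0 : E N) (M + r)) := isCompact_closedBall _ _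
  set f₁ := indicator (closedBall (0 : E N) (M + r)) f with hf₁
  have hf₁i : Integrable f₁ volume :=
    (integrable_indicator_iff hK.measurableSet).2 (hf.integrableOn_isCompact hK)
  have heq : ∀ x ∈ unitCell N, ∀ t, ρ t * f₁ (x - t) = ρ t * f (x - t) := by
    intro x hx t
    by_cases ht : t ∈ tsupport ρ
    · congr 1
      refine indicator_of_mem ?_ f
      have h1 := mem_closedBall_zero_iff.1 (hM hx)
      have h2 := mem_closedBall_zero_iff.1 (hr ht)
      rw [mem_closedBall_zero_iff]
      linarith [norm_sub_le x t]
    · rw [image_eq_zero_of_notMem_tsupport ht, zero_mul, zero_mul]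
  have hint : Integrable (Function.uncurry fun x t : E N => ρ t * f₁ (x - t))
      ((volume.restrict (unitCell N)).prod volume) := by
    have h := Integrable.convolution_integrand (ContinuousLinearMap.mul ℝ ℝ)
      (μ := (volume : Measure (E N))) (ν := volume) (hρ.integrable_of_hasCompactSupport hρs) hf₁i
    have h2 := h.integrableOn (s := unitCell N ×ˢ univ)
    rw [IntegrableOn, ← Measure.prod_restrict, Measure.restrict_univ] at h2
    exact h2
  have hms : MeasurableSet (unitCell N) := isCompact_unitCell.measurableSet
  calc ∫ x in unitCell N, ∫ t, ρ t * f (x - t)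
      = ∫ x in unitCell N, ∫ t, ρ t * f₁ (x - t) :=
        setIntegral_congr_fun hms fun x hx => by simp only [heq x hx]
    _ = ∫ t, ∫ x in unitCell N, ρ t * f₁ (x - t) := integral_integral_swap hint
    _ = ∫ t, ρ t * ∫ x in unitCell N, f x := by
        congr 1 with t
        rw [setIntegral_congr_fun hms fun x hx => heq x hx t, integral_const_mul,
          setIntegral_unitCell_sub hper]
    _ = (∫ t, ρ t) * ∫ x in unitCell N, f x := integral_mul_const _ _

theorem MemH1per.grad_periodic {u : E N → ℝ} {g : E N → E N} (h : MemH1per u g)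
    (k : Fin N → ℤ) : ∀ᵐ x, g (x + latticePt k) = g x :=
  h.memH1loc.grad_periodic (h.periodic k)

/-- The weak gradient of a periodic function has mean zero over the unit cell: averaging over
translations moves the derivative to a smooth kernel. -/
theorem MemH1per.integral_inner_grad_eq_zero {u : E N → ℝ} {g : E N → E N} (h : MemH1per u g)
    (v : E N) : ∫ x in unitCell N, inner ℝ v (g x) = 0 := by
  let η : ContDiffBump (0 : E N) := ⟨1, 2, by norm_num, by norm_num⟩
  have hρ : IsTestFun (η.normed volume) := ⟨η.contDiff_normed, η.hasCompactSupport_normed⟩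
  have h1 := setIntegral_unitCell_average (f := fun x => inner ℝ v (g x))
    (h.memH1loc.locL2_grad.locallyIntegrable_inner v)
    (fun k => (h.grad_periodic k).mono fun x hx => by rw [hx]) hρ.continuous hρ.2
  have h2 := setIntegral_unitCell_average h.memH1loc.locL2_fun.locallyIntegrable h.periodic
    (hρ.fderiv_apply v).continuous (hρ.fderiv_apply v).2
  rw [η.integral_normed, one_mul] at h1
  rw [hρ.integral_fderiv_eq_zero, zero_mul] at h2
  rw [← h1, ← h2]
  congr 1 with x
  have h3 := (h.memH1loc.comp_affine (s := -1) (by norm_num) x).integral_mul_fderiv hρ v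
  have h4 : ∀ t : E N, (-1 : ℝ) • t + x = x - t := fun t => by rw [neg_one_smul]; abel
  simp only [h4, inv_neg, inv_one, neg_mul, one_mul, integral_neg, neg_inj] at h3
  simp only [mul_comm (fderiv ℝ _ _ v)]
  simpa only [real_inner_comm v] using h3.symm

end Periodic

namespace IsPeriodicBallCover

open scoped Pointwise

variable {N : ℕ} {ι : Type*} {c : ι → E N} {ρ : ι → ℝ} {α β R m : ℝ} {e : E N}
  {w u : E N → ℝ} {g h : E N → E N}

/-- Equality of the centres modulo `ℤ^N`. -/
def translateSetoid (c : ι → E N) : Setoid ι where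
  r p q := ∃ k : Fin N → ℤ, c q = c p + latticePt k
  iseqv :=
    { refl := fun p => ⟨0, by ext i; simp [latticePt]⟩
      symm := fun {p q} ⟨k, hk⟩ => ⟨-k, by rw [hk, latticePt_neg, add_neg_cancel_right]⟩
      trans := fun {p q r} ⟨k, hk⟩ ⟨l, hl⟩ => ⟨k + l, by rw [hl, hk, latticePt_add, add_assoc]⟩ }

/-- Representatives of the balls modulo `ℤ^N`-translations form a fundamental domain. -/
theorem isAddFundamentalDomain_iUnion_out (hc : IsPeriodicBallCover c ρ) :
    IsAddFundamentalDomain (intLattice N)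
      (⋃ r : Quotient (translateSetoid c), ball (c r.out) (ρ r.out)) volume := by
  refine ⟨(isOpen_iUnion fun _ => isOpen_ball).measurableSet.nullMeasurableSet, ?_, ?_⟩
  · filter_upwards [hc.ae_exists_mem] with x hx
    obtain ⟨p, hp⟩ := mem_iUnion.1 hx
    obtain ⟨k, hk⟩ : ∃ k : Fin N → ℤ, c (Quotient.mk (translateSetoid c) p).out
        = c p + latticePt k := (translateSetoid c).symm (Quotient.mk_out p)
    obtain ⟨q, hq, -, hx⟩ := hc.exists_translate_mem k hp
    have hqr : q = (Quotient.mk (translateSetoid c) p).out := by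
      refine hc.eq_of_mem (mem_ball_self (hc.radius_pos q)) ?_
      rw [hq, ← hk]
      exact mem_ball_self (hc.radius_pos _)
    refine ⟨⟨latticePt k, mem_intLattice.2 ⟨k, rfl⟩⟩,
      mem_iUnion.2 ⟨Quotient.mk (translateSetoid c) p, ?_⟩⟩
    rw [AddSubgroup.mk_vadd, vadd_eq_add, add_comm, ← hqr]
    exact hx
  · rintro ⟨l, hl⟩ ⟨l', hl'⟩ hne
    obtain ⟨k, rfl⟩ := mem_intLattice.1 hl
    obtain ⟨k', rfl⟩ := mem_intLattice.1 hl'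
    refine Disjoint.aedisjoint (Set.disjoint_left.2 fun x hx hx' => hne ?_)
    simp only [mem_vadd_set_iff_neg_vadd_mem, mem_iUnion] at hx hx'
    obtain ⟨r, hr⟩ := hx
    obtain ⟨r', hr'⟩ := hx'
    obtain ⟨q, hq, -, hxq⟩ := hc.exists_translate_mem k hr
    obtain ⟨q', hq', -, hxq'⟩ := hc.exists_translate_mem k' hr'
    have e1 : x ∈ ball (c q) (ρ q) := by simpa [AddSubgroup.vadd_def] using hxq
    have e2 : x ∈ ball (c q') (ρ q') := by simpa [AddSubgroup.vadd_def] using hxq'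
    have hqq := hc.eq_of_mem e1 e2
    rw [← hqq, hq] at hq'
    have hrr : r = r' := by
      rw [← r.out_eq, ← r'.out_eq]
      exact Quotient.sound ⟨k - k', by
        rw [sub_eq_add_neg, latticePt_add, latticePt_neg, ← add_assoc, hq', add_neg_cancel_right]⟩
    rw [hrr] at hq'
    exact Subtype.ext (add_left_cancel hq')

theorem hsCoeff_add_latticePt (hc : IsPeriodicBallCover c ρ) (k : Fin N → ℤ) (x : E N) :
    hsCoeff α β R c ρ (x + latticePt k) = hsCoeff α β R c ρ x :=
  hc.paste_add_latticePt (fun _ _ _ => rfl) k x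

theorem hsCorrector_add_latticePt (hc : IsPeriodicBallCover c ρ) (k : Fin N → ℤ) (x : E N) :
    hsCorrector c ρ e w (x + latticePt k) = hsCorrector c ρ e w x :=
  hc.paste_add_latticePt (fun _ _ hpq => by rw [hpq]) k x

theorem hsCorrectorGrad_add_latticePt (hc : IsPeriodicBallCover c ρ) (k : Fin N → ℤ) (x : E N) :
    hsCorrectorGrad c ρ e g (x + latticePt k) = hsCorrectorGrad c ρ e g x :=
  hc.paste_add_latticePt (fun _ _ _ => rfl) k x

variable [Countable ι]

/-- The integral over the unit cell of a periodic function vanishes if the integral over each ball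
does, since the unit cell may be exchanged for a union of balls. -/
theorem setIntegral_unitCell_eq_zero (hc : IsPeriodicBallCover c ρ) {f : E N → ℝ}
    (hf : IntegrableOn f (unitCell N) volume)
    (hper : ∀ k : Fin N → ℤ, ∀ᵐ x, f (x + latticePt k) = f x)
    (h : ∀ p, ∫ x in ball (c p) (ρ p), f x = 0) : ∫ x in unitCell N, f x = 0 := by
  have hD := hc.isAddFundamentalDomain_iUnion_out
  rw [setIntegral_eq_of_ae_periodic hper isAddFundamentalDomain_unitCell hD,
    integral_iUnion (fun _ => isOpen_ball.measurableSet) ?_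
      (integrableOn_of_ae_periodic hper isAddFundamentalDomain_unitCell hD hf)]
  · simp [h]
  · intro r r' hrr
    refine hc.disjoint fun hout => hrr ?_
    rw [← r.out_eq, ← r'.out_eq, hout]

theorem integrableOn_flux (hc : IsPeriodicBallCover c ρ) (hg : LocL2 g) (hh : LocL2 h) (e : E N)
    (α β R : ℝ) {s : Set (E N)} (hs : Bornology.IsBounded s) :
    IntegrableOn (fun x => hsCoeff α β R c ρ x * inner ℝ (g x + e) (h x)) s volume := by
  simpa only [real_inner_smul_left] using
    (hc.locL2_flux hg e α β R).integrableOn_inner hh hs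

/-- Over the unit cell, the flux of the corrector is indistinguishable from the constant flux `m e`
when tested against periodic weak gradients. -/
theorem integral_flux_unitCell (hc : IsPeriodicBallCover c ρ) (hN : 1 ≤ N)
    (hw : IsBallSolution α β R m e w g) (hu : MemH1loc u h)
    (hper : ∀ k : Fin N → ℤ, ∀ᵐ x, h (x + latticePt k) = h x) :
    ∫ x in unitCell N, hsCoeff α β R c ρ x * inner ℝ (hsCorrectorGrad c ρ e g x + e) (h x)
      = m * ∫ x in unitCell N, inner ℝ e (h x) := by
  have h1 : ∀ {s : Set (E N)}, Bornology.IsBounded s → IntegrableOn (fun x =>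
      hsCoeff α β R c ρ x * inner ℝ (hsCorrectorGrad c ρ e g x + e) (h x)) s volume :=
    fun hs => hc.integrableOn_flux (hc.memH1loc_hsCorrector hN hw).locL2_grad hu.locL2_grad
      e α β R hs
  have h2 : ∀ {s : Set (E N)}, Bornology.IsBounded s →
      IntegrableOn (fun x => m * inner ℝ e (h x)) s volume :=
    fun hs => (continuous_const.locL2.integrableOn_inner hu.locL2_grad hs).const_mul m
  have hY := (isCompact_unitCell (N := N)).isBounded
  rw [← integral_const_mul, ← sub_eq_zero, ← integral_sub (h1 hY) (h2 hY)]
  refine hc.setIntegral_unitCell_eq_zero ((h1 hY).sub (h2 hY)) (fun k => ?_) fun p => ?_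
  · filter_upwards [hper k] with x hx
    rw [hc.hsCoeff_add_latticePt, hc.hsCorrectorGrad_add_latticePt, hx]
  · rw [integral_sub (h1 isBounded_ball) (h2 isBounded_ball), hc.integral_flux_ball hw hu p,
      integral_const_mul, sub_self]

/-- The corrector, normalised to mean zero, solves the cell problem. -/
theorem isCellSolution_hsCorrector (hc : IsPeriodicBallCover c ρ) (hN : 1 ≤ N)
    (hw : IsBallSolution α β R m e w g) :
    IsCellSolution (hsCoeff α β R c ρ) e
      (fun x => hsCorrector c ρ e w x - ⨍ y in unitCell N, hsCorrector c ρ e w y)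
      (hsCorrectorGrad c ρ e g) := by
  refine ⟨⟨?_, fun k => ?_⟩, ?_, fun φ h hφ => ?_⟩
  · simpa only [sub_zero] using (hc.memH1loc_hsCorrector hN hw).sub
      (memH1loc_const (⨍ y in unitCell N, hsCorrector c ρ e w y))
  · exact Filter.Eventually.of_forall fun x => by simp only [hc.hsCorrector_add_latticePt]
  · have : IsFiniteMeasure (volume.restrict (unitCell N)) := ⟨by simp [volume_unitCell]⟩
    exact integral_sub_average _ _
  · rw [hc.integral_flux_unitCell hN hw hφ.memH1loc hφ.grad_periodic,
      hφ.integral_inner_grad_eq_zero, mul_zero]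

/-- The effective coefficient. By the symmetry of the energy and the two cell equations it may be
computed with the pasted corrector in place of one of the given cell solutions. -/
theorem average_flux_eq (hc : IsPeriodicBallCover c ρ) (hN : 1 ≤ N) {e' : E N}
    (hw : IsBallSolution α β R m e' w g) {χ χ' : E N → ℝ} {γ γ' : E N → E N}
    (hχ : IsCellSolution (hsCoeff α β R c ρ) e χ γ)
    (hχ' : IsCellSolution (hsCoeff α β R c ρ) e' χ' γ') :
    ⨍ x in unitCell N, hsCoeff α β R c ρ x * inner ℝ (γ x + e) (γ' x + e') = m * inner ℝ e e' := by
  have hX := hc.isCellSolution_hsCorrector hN hw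
  set G := hsCorrectorGrad c ρ e' g with hG
  have hY := (isCompact_unitCell (N := N)).isBounded
  -- by its own equation, the flux of a cell solution sees only the mean of the test gradient
  have key : ∀ {d d' : E N} {ψ ψ' : E N → ℝ} {δ δ' : E N → E N},
      IsCellSolution (hsCoeff α β R c ρ) d ψ δ → MemH1per ψ' δ' →
      ∫ x in unitCell N, hsCoeff α β R c ρ x * inner ℝ (δ x + d) (δ' x + d')
        = ∫ x in unitCell N, hsCoeff α β R c ρ x * inner ℝ (δ x + d) d' := by
    intro d d' ψ ψ' δ δ' h1 h2
    have i1 := hc.integrableOn_flux h1.memH1per.memH1loc.locL2_grad h2.memH1loc.locL2_grad d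
      α β R hY
    have i2 := hc.integrableOn_flux h1.memH1per.memH1loc.locL2_grad
      (continuous_const (y := d')).locL2 d α β R hY
    simp only [inner_add_right (𝕜 := ℝ) (_ + d), mul_add]
    rw [integral_add i1 i2, h1.equation _ _ h2, zero_add]
  have h1 : ∫ x in unitCell N, hsCoeff α β R c ρ x * inner ℝ (γ x + e) (γ' x + e')
      = m * inner ℝ e e' := by
    rw [key hχ hχ'.memH1per, ← key hχ hX.memH1per]
    simp only [real_inner_comm (_ + e') (_ + e)]
    rw [key hX hχ.memH1per, hc.integral_flux_unitCell hN hw (memH1loc_inner e)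
      fun _ => Filter.Eventually.of_forall fun _ => rfl]
    simp [volume_unitCell, Measure.real, real_inner_comm]
  rw [setAverage_eq, h1]
  simp [volume_unitCell, Measure.real]

end IsPeriodicBallCover

/-! ### The explicit solution on the unit ball -/

section Existence

variable {N : ℕ} {u : E N → ℝ} {g : E N → E N}

theorem MemH1loc.smooth_mul (h : MemH1loc u g) {ψ : E N → ℝ} (hψ : ContDiff ℝ ∞ ψ) :
    MemH1loc (fun x => ψ x * u x) (fun x => ψ x • g x + u x • gradient ψ x) := by
  have hmul : ∀ {V : Type} [NormedAddCommGroup V] [NormedSpace ℝ V] {a : E N → ℝ} {b : E N → V},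
      Continuous a → LocL2 b → LocL2 fun x => a x • b x := by
    intro V _ _ a b ha hb K hK
    obtain ⟨C, hC⟩ := hK.exists_bound_of_continuousOn ha.continuousOn
    exact MemLp.smul (hb K hK) (memLp_top_of_bound ha.aestronglyMeasurable C
      ((ae_restrict_iff' hK.measurableSet).2 (Filter.Eventually.of_forall hC)))
  have hψ' := hψ.continuous_gradient
  have hug : LocL2 fun x => u x • gradient ψ x := by
    intro K hK
    obtain ⟨C, hC⟩ := hK.exists_bound_of_continuousOn hψ'.continuousOn
    exact MemLp.smul (memLp_top_of_bound hψ'.aestronglyMeasurable C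
      ((ae_restrict_iff' hK.measurableSet).2 (Filter.Eventually.of_forall hC)))
      (h.locL2_fun K hK)
  refine memH1loc_of_integral_mul_fderiv (hmul hψ.continuous h.locL2_fun)
    ((hmul hψ.continuous h.locL2_grad).add hug) fun φ hφ v => ?_
  have h1 := h.integral_mul_fderiv (hφ.smooth_mul hψ) v
  have h2 : ∀ x, fderiv ℝ (fun x => ψ x * φ x) x v
      = ψ x * fderiv ℝ φ x v + φ x * fderiv ℝ ψ x v := by
    intro x
    rw [fderiv_fun_mul (hψ.differentiable (by simp) x) (hφ.differentiable x)]
    simp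
  have h3 : Integrable fun x => φ x * (u x * fderiv ℝ ψ x v) := by
    have := (hug.integrable_smul_test hφ.continuous hφ.2).inner_const (𝕜 := ℝ) v
    simpa only [real_inner_smul_left, inner_gradient_left] using this
  have h4 : Integrable fun x => ψ x * u x * fderiv ℝ φ x v :=
    (hmul hψ.continuous h.locL2_fun).locallyIntegrable.integrable_smul_right_of_hasCompactSupport
      (hφ.fderiv_apply v).continuous (hφ.fderiv_apply v).2
  have h5 : Integrable fun x => ψ x * φ x * inner ℝ (g x) v := by
    have := (h.locL2_grad.integrable_smul_test (hφ.smooth_mul hψ).continuous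
      (hφ.smooth_mul hψ).2).inner_const (𝕜 := ℝ) v
    simpa only [real_inner_smul_left] using this
  have h6 : ∫ x, u x * fderiv ℝ (fun x => ψ x * φ x) x v
      = (∫ x, ψ x * u x * fderiv ℝ φ x v) + ∫ x, φ x * (u x * fderiv ℝ ψ x v) := by
    rw [← integral_add h4 h3]
    congr 1 with x
    rw [h2]; ring
  have h7 : ∫ x, φ x * inner ℝ (ψ x • g x + u x • gradient ψ x) v
      = (∫ x, ψ x * φ x * inner ℝ (g x) v) + ∫ x, φ x * (u x * fderiv ℝ ψ x v) := by
    rw [← integral_add h5 h3]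
    congr 1 with x
    rw [inner_add_left, real_inner_smul_left, real_inner_smul_left, inner_gradient_left]; ring
  rw [h7]
  linarith

/-- Integration by parts against the position field. -/
theorem MemH1loc.integral_mul_inner_self (h : MemH1loc u g) {θ : E N → ℝ} (hθ : IsTestFun θ) :
    ∫ x, θ x * inner ℝ (g x) x = -∫ x, u x * (N * θ x + fderiv ℝ θ x x) := by
  set b := EuclideanSpace.basisFun (Fin N) ℝ with hb
  have hψ : ∀ i, ContDiff ℝ ∞ fun x : E N => inner ℝ (b i) x := fun i =>
    contDiff_const.inner ℝ contDiff_id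
  have h1 : ∀ i, ∫ x, u x * fderiv ℝ (fun x => inner ℝ (b i) x * θ x) x (b i)
      = -∫ x, (inner ℝ (b i) x * θ x) * inner ℝ (g x) (b i) := fun i =>
    h.integral_mul_fderiv (hθ.smooth_mul (hψ i)) (b i)
  have h2 : ∀ i x, fderiv ℝ (fun x => inner ℝ (b i) x * θ x) x (b i)
      = θ x + inner ℝ (b i) x * fderiv ℝ θ x (b i) := by
    intro i x
    rw [fderiv_fun_mul ((hψ i).differentiable (by simp) x) (hθ.differentiable x)]
    have h3 : fderiv ℝ (fun x : E N => inner ℝ (b i) x) x = innerSL ℝ (b i) :=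
      (innerSL ℝ (b i)).fderiv
    rw [h3]
    simp [add_comm]
  have h3 : ∀ x : E N, ∑ i, inner ℝ (b i) x • b i = x := fun x => b.sum_repr' x
  have i1 : ∀ i, Integrable fun x => u x * fderiv ℝ (fun x => inner ℝ (b i) x * θ x) x (b i) :=
    fun i => h.locL2_fun.locallyIntegrable.integrable_smul_right_of_hasCompactSupport
      ((hθ.smooth_mul (hψ i)).fderiv_apply (b i)).continuous
      ((hθ.smooth_mul (hψ i)).fderiv_apply (b i)).2
  have i2 : ∀ i, Integrable fun x => (inner ℝ (b i) x * θ x) * inner ℝ (g x) (b i) := fun i => by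
    have := (h.locL2_grad.integrable_smul_test (hθ.smooth_mul (hψ i)).continuous
      (hθ.smooth_mul (hψ i)).2).inner_const (𝕜 := ℝ) (b i)
    simpa only [real_inner_smul_left] using this
  have h4 : ∫ x, θ x * inner ℝ (g x) x
      = ∑ i, ∫ x, (inner ℝ (b i) x * θ x) * inner ℝ (g x) (b i) := by
    rw [← integral_finsetSum _ fun i _ => i2 i]
    congr 1 with x
    conv_lhs => rw [← h3 x, inner_sum, Finset.mul_sum, h3 x]
    refine Finset.sum_congr rfl fun i _ => ?_
    rw [real_inner_smul_right]; ring
  have h5 : ∫ x, u x * (N * θ x + fderiv ℝ θ x x)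
      = ∑ i, ∫ x, u x * fderiv ℝ (fun x => inner ℝ (b i) x * θ x) x (b i) := by
    rw [← integral_finsetSum _ fun i _ => i1 i]
    congr 1 with x
    rw [← Finset.mul_sum]
    simp only [h2, Finset.sum_add_distrib]
    have h6 : fderiv ℝ θ x x = ∑ i, inner ℝ (b i) x * fderiv ℝ θ x (b i) := by
      conv_lhs => rw [← h3 x, map_sum, h3 x]
      simp
    rw [← h6]
    simp
  rw [h4, h5, ← Finset.sum_neg_distrib]
  exact Finset.sum_congr rfl fun i _ => by rw [h1, neg_neg]

/-- The row-wise divergence `(N - 1) u e + (x · ∇u) e - (e · ∇u) x` of the antisymmetric matrix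
field `u(x) (e ⊗ x - x ⊗ e)` is divergence-free. -/
theorem MemH1loc.integral_antisymmetric_flux (h : MemH1loc u g) (e : E N) {φ : E N → ℝ}
    (hφ : IsTestFun φ) :
    ∫ x, ((N - 1) * u x * fderiv ℝ φ x e + inner ℝ (g x) x * fderiv ℝ φ x e
      - inner ℝ (g x) e * fderiv ℝ φ x x) = 0 := by
  have hdφ : ContDiff ℝ ∞ (fderiv ℝ φ) := hφ.1.fderiv_right (by simp)
  have hθ : IsTestFun fun x => fderiv ℝ φ x e := hφ.fderiv_apply e
  have hκ : IsTestFun fun x => fderiv ℝ φ x x := hφ.fderiv_self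
  have d2 : ∀ x, HasFDerivAt (fderiv ℝ φ) (fderiv ℝ (fderiv ℝ φ) x) x := fun x =>
    (hdφ.differentiable (by simp) x).hasFDerivAt
  have e1 : ∀ x, fderiv ℝ (fun x => fderiv ℝ φ x e) x x = fderiv ℝ (fderiv ℝ φ) x x e := fun x => by
    rw [((d2 x).clm_apply (hasFDerivAt_const e x)).fderiv]; simp
  have e2 : ∀ x, fderiv ℝ (fun x => fderiv ℝ φ x x) x e
      = fderiv ℝ φ x e + fderiv ℝ (fderiv ℝ φ) x x e := fun x => by
    have hd := (d2 x).clm_apply (hasFDerivAt_id x)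
    simp only [id_eq] at hd
    rw [hd.fderiv]
    have hs : IsSymmSndFDerivAt ℝ φ x := hφ.1.contDiffAt.isSymmSndFDerivAt
      (by simp only [minSmoothness_of_isRCLikeNormedField]; exact ENat.LEInfty.out)
    simp [hs.eq e x]
  have a1 := h.integral_mul_inner_self hθ
  have a2 := h.integral_mul_fderiv hκ e
  simp only [e1] at a1
  simp only [e2] at a2
  have hu : ∀ {θ : E N → ℝ}, IsTestFun θ → Integrable fun x => u x * θ x := fun hθ =>
    h.locL2_fun.locallyIntegrable.integrable_smul_right_of_hasCompactSupport hθ.continuous hθ.2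
  have i1 : Integrable fun x => inner ℝ (g x) x * fderiv ℝ φ x e := by
    have h1 := h.locL2_grad.integrableOn_inner (hθ.continuous.smul continuous_id).locL2
      hθ.2.isCompact.isBounded
    have h2 := (integrableOn_iff_integrable_of_support_subset fun x hx => ?_).1 h1
    · simpa only [Pi.smul_apply', id_eq, real_inner_smul_right, mul_comm] using h2
    · refine subset_tsupport _ fun h0 => hx ?_
      simp [h0]
  have i2 : Integrable fun x => fderiv ℝ φ x x * inner ℝ (g x) e := by
    have := (h.locL2_grad.integrable_smul_test hκ.continuous hκ.2).inner_const (𝕜 := ℝ) e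
    simpa only [real_inner_smul_left] using this
  have i3 := hu hθ
  have i4 := hu hθ.fderiv_self
  simp only [e1] at i4
  have r1 : ∫ x, u x * (N * fderiv ℝ φ x e + fderiv ℝ (fderiv ℝ φ) x x e)
      = N * (∫ x, u x * fderiv ℝ φ x e) + ∫ x, u x * fderiv ℝ (fderiv ℝ φ) x x e := by
    rw [← integral_const_mul, ← integral_add (i3.const_mul _) i4]
    congr 1 with x
    ring
  have r2 : ∫ x, u x * (fderiv ℝ φ x e + fderiv ℝ (fderiv ℝ φ) x x e)
      = (∫ x, u x * fderiv ℝ φ x e) + ∫ x, u x * fderiv ℝ (fderiv ℝ φ) x x e := by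
    simp only [mul_add]
    exact integral_add i3 i4
  have r3 : ∫ x, ((N - 1) * u x * fderiv ℝ φ x e + inner ℝ (g x) x * fderiv ℝ φ x e
      - inner ℝ (g x) e * fderiv ℝ φ x x)
      = (N - 1) * (∫ x, u x * fderiv ℝ φ x e) + (∫ x, fderiv ℝ φ x e * inner ℝ (g x) x)
        - ∫ x, fderiv ℝ φ x x * inner ℝ (g x) e := by
    simp only [mul_comm (fderiv ℝ φ _ _)] at i1 i2 ⊢
    have i5 : Integrable fun x => (N - 1 : ℝ) * (u x * fderiv ℝ φ x e)
        + inner ℝ (g x) x * fderiv ℝ φ x e := (i3.const_mul _).add i1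
    rw [← integral_const_mul, ← integral_add (i3.const_mul _) i1, ← integral_sub i5 i2]
    congr 1 with x
    ring
  rw [r1] at a1
  rw [r2] at a2
  rw [r3, a1]
  linarith

/-- The distance to the origin, clamped to `[R, 1]`. -/
noncomputable def clampedNorm (R : ℝ) (y : E N) : ℝ := max R (min ‖y‖ 1)

/-- The radial function `1 - r^{-N}` in the coating `R < r < 1`, extended by constants. -/
noncomputable def coatingPotential (R : ℝ) (y : E N) : ℝ := 1 - clampedNorm R y ^ (-(N : ℤ))

/-- The gradient of `coatingPotential`. -/
noncomputable def coatingGrad (R : ℝ) (y : E N) : E N :=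
  if R < ‖y‖ ∧ ‖y‖ < 1 then (N * ‖y‖ ^ (-(N : ℤ) - 2)) • y else 0

variable {R : ℝ}

theorem clampedNorm_mem (hR1 : R < 1) (y : E N) : clampedNorm R y ∈ Icc R 1 :=
  ⟨le_max_left _ _, max_le hR1.le (min_le_right _ _)⟩

theorem exists_lipschitzWith_coatingPotential (hR0 : 0 < R) (hR1 : R < 1) :
    ∃ C, LipschitzWith C (coatingPotential R : E N → ℝ) := by
  have hd : ∀ s ∈ Icc R 1, HasDerivWithinAt (fun s : ℝ => 1 - s ^ (-(N : ℤ)))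
      (-((-(N : ℤ) : ℤ) * s ^ (-(N : ℤ) - 1))) (Icc R 1) s := fun s hs =>
    ((hasDerivAt_zpow _ s (Or.inl (hR0.trans_le hs.1).ne')).const_sub 1).hasDerivWithinAt
  have hcont : ContinuousOn (fun s : ℝ => -((-(N : ℤ) : ℤ) * s ^ (-(N : ℤ) - 1))) (Icc R 1) := by
    refine ContinuousOn.neg (continuousOn_const.mul ?_)
    exact ContinuousOn.zpow₀ continuousOn_id _ fun s hs => Or.inl (hR0.trans_le hs.1).ne'
  obtain ⟨C, hC⟩ := isCompact_Icc.exists_bound_of_continuousOn hcont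
  have h1 : LipschitzOnWith C.toNNReal (fun s : ℝ => 1 - s ^ (-(N : ℤ))) (Icc R 1) :=
    (convex_Icc R 1).lipschitzOnWith_of_nnnorm_hasDerivWithin_le hd fun s hs => by
      rw [← NNReal.coe_le_coe, coe_nnnorm]
      exact (hC s hs).trans (Real.le_coe_toNNReal C)
  have h2 : LipschitzWith 1 (clampedNorm R : E N → ℝ) :=
    (lipschitzWith_one_norm.min_const 1).const_max R
  refine ⟨C.toNNReal * 1, fun x y => ?_⟩
  have h3 := h1 (clampedNorm_mem hR1 x) (clampedNorm_mem hR1 y)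
  refine h3.trans ?_
  rw [mul_one]
  gcongr
  simpa using h2 x y

theorem hasFDerivAt_coatingPotential (hR0 : 0 < R) {y : E N} (hR : ‖y‖ ≠ R) (h1 : ‖y‖ ≠ 1)
    (hR1 : R < 1) : HasFDerivAt (coatingPotential R) (innerSL ℝ (coatingGrad R y)) y := by
  have hn : Continuous fun y : E N => ‖y‖ := continuous_norm
  rcases lt_or_gt_of_ne hR with hlt | hgt
  · have hloc : (coatingPotential R : E N → ℝ) =ᶠ[nhds y] fun _ => 1 - R ^ (-(N : ℤ)) := by
      filter_upwards [hn.continuousAt.eventually_lt_const hlt] with z hz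
      rw [coatingPotential, clampedNorm, min_eq_left (hz.trans hR1).le, max_eq_left hz.le]
    rw [coatingGrad, if_neg (fun h => hlt.not_gt h.1), map_zero]
    exact (hasFDerivAt_const _ y).congr_of_eventuallyEq hloc
  rcases lt_or_gt_of_ne h1 with hlt1 | hgt1
  · have hy : 0 < ‖y‖ := hR0.trans hgt
    have hloc : (coatingPotential R : E N → ℝ) =ᶠ[nhds y] fun z => 1 - ‖z‖ ^ (-(N : ℤ)) := by
      filter_upwards [hn.continuousAt.eventually_lt_const hlt1,
        hn.continuousAt.eventually_const_lt hgt] with z hz hz'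
      rw [coatingPotential, clampedNorm, min_eq_left hz.le, max_eq_right hz'.le]
    have hnorm : HasFDerivAt (fun z : E N => ‖z‖) (‖y‖⁻¹ • innerSL ℝ y) y := by
      have hsq := (hasStrictFDerivAt_norm_sq y).hasFDerivAt.sqrt (by positivity)
      simp only [Real.sqrt_sq (norm_nonneg _)] at hsq
      refine hsq.congr_fderiv ?_
      ext v
      simp
      ring
    have hz := (hasDerivAt_zpow (-(N : ℤ)) ‖y‖ (Or.inl hy.ne')).const_sub 1
    have hcomp := hz.comp_hasFDerivAt y hnorm
    rw [coatingGrad, if_pos ⟨hgt, hlt1⟩]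
    refine HasFDerivAt.congr_of_eventuallyEq ?_ hloc
    refine hcomp.congr_fderiv ?_
    ext v
    have hpow : ‖y‖ ^ (-(N : ℤ) - 1) = ‖y‖ ^ (-(N : ℤ) - 2) * ‖y‖ := by
      rw [← zpow_add_one₀ hy.ne']; congr 1; ring
    rw [hpow]
    simp
    field_simp
  · have hloc : (coatingPotential R : E N → ℝ) =ᶠ[nhds y] fun _ => 0 := by
      filter_upwards [hn.continuousAt.eventually_const_lt hgt1] with z hz
      rw [coatingPotential, clampedNorm, min_eq_right hz.le, max_eq_right hR1.le]
      simp
    rw [coatingGrad, if_neg (fun h => hgt1.not_gt h.2), map_zero]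
    exact (hasFDerivAt_const _ y).congr_of_eventuallyEq hloc

theorem ae_norm_ne {r : ℝ} (hr : r ≠ 0) : ∀ᵐ y : E N, ‖y‖ ≠ r := by
  have h := measure_eq_zero_iff_ae_notMem.1
    (Measure.addHaar_sphere_of_ne_zero volume (0 : E N) hr)
  filter_upwards [h] with y hy hh
  exact hy (by simp [hh])

theorem measurable_coatingGrad (R : ℝ) : Measurable (coatingGrad R : E N → E N) := by
  refine Measurable.ite ((measurableSet_lt measurable_const measurable_norm).inter
    (measurableSet_lt measurable_norm measurable_const)) ?_ measurable_const
  exact (((measurable_norm (α := E N)).pow_const (-(N : ℤ) - 2)).const_mul (N : ℝ)).smul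
    measurable_id

theorem memH1loc_coatingPotential (hR0 : 0 < R) (hR1 : R < 1) :
    MemH1loc (coatingPotential R : E N → ℝ) (coatingGrad R) := by
  obtain ⟨C, hC⟩ := exists_lipschitzWith_coatingPotential (N := N) hR0 hR1
  have hgrad : LocL2 (coatingGrad R : E N → E N) := by
    intro K hK
    have : IsFiniteMeasure (volume.restrict K) := ⟨by simpa using hK.measure_lt_top⟩
    refine MemLp.of_bound (measurable_coatingGrad R).aestronglyMeasurable C
      (ae_restrict_of_ae ?_)
    filter_upwards [ae_norm_ne hR0.ne', ae_norm_ne one_ne_zero] with y h1 h2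
    have h3 := (hasFDerivAt_coatingPotential hR0 h1 h2 hR1).le_of_lipschitz hC
    rwa [innerSL_apply_norm] at h3
  refine memH1loc_of_integral_mul_fderiv hC.continuous.locL2 hgrad fun φ hφ v => ?_
  -- integration by parts is available for line derivatives of Lipschitz functions
  obtain ⟨D, hD⟩ := hφ.1.lipschitzWith_of_hasCompactSupport hφ.2 (by simp)
  have h := hC.integral_lineDeriv_mul_eq hD hφ.2 (μ := volume) v
  have h1 : ∫ x, lineDeriv ℝ (coatingPotential R) x v * φ x
      = ∫ x, φ x * inner ℝ (coatingGrad R x) v := by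
    refine integral_congr_ae ?_
    filter_upwards [ae_norm_ne (N := N) hR0.ne', ae_norm_ne one_ne_zero] with y h1 h2
    rw [((hasFDerivAt_coatingPotential hR0 h1 h2 hR1).hasLineDerivAt v).lineDeriv, mul_comm]
    rfl
  have h2 : ∫ x, lineDeriv ℝ φ x (-v) * coatingPotential R x
      = -∫ x, coatingPotential R x * fderiv ℝ φ x v := by
    rw [← integral_neg]
    congr 1 with x
    rw [(hφ.differentiable x).lineDeriv_eq_fderiv, map_neg]
    ring
  rw [← h1, h, h2, neg_neg]

end Existence

section Explicit

variable {N : ℕ} {α β R m C : ℝ}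

theorem coatingPotential_outside (hR1 : R < 1) {y : E N} (hy : 1 ≤ ‖y‖) :
    coatingPotential R y = 0 := by
  rw [coatingPotential, clampedNorm, min_eq_right hy, max_eq_right hR1.le]
  simp

/-- The explicit solution. The two hypotheses say that the flux is continuous across `‖y‖ = 1` and
`‖y‖ = R`; they make `a_B g - m e` equal to the divergence of the antisymmetric matrix field
`β C P(y) (e ⊗ y - y ⊗ e)`, where `P` is `coatingPotential R`. -/
theorem isBallSolution_explicit (hR0 : 0 < R) (hR1 : R < 1) (h1 : m = β * (1 - N * C))
    (h2 : α * (1 - C * (1 - R ^ (-(N : ℤ)))) = m + β * C * (N - 1) * (1 - R ^ (-(N : ℤ))))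
    (e : E N) :
    IsBallSolution α β R m e
      (fun y => inner ℝ e y - inner ℝ (C • e) y * coatingPotential R y)
      (fun y => e - (inner ℝ (C • e) y • coatingGrad R y + coatingPotential R y • C • e)) := by
  have hP := memH1loc_coatingPotential (N := N) hR0 hR1
  have hψ : ContDiff ℝ ∞ fun y : E N => inner ℝ (C • e) y := contDiff_const.inner ℝ contDiff_id
  have hH1 := (memH1loc_inner e).sub (hP.smooth_mul hψ)
  simp only [gradient_inner_left] at hH1
  refine ⟨hH1, Filter.Eventually.of_forall fun y hy => ?_, fun φ hφ => ?_⟩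
  · rw [coatingPotential_outside hR1 hy, mul_zero, sub_zero]
  have i1 := (hH1.locL2_grad.bdd_smul (measurable_profileExt α β R m).aestronglyMeasurable
    (abs_profileExt_le α β R m)).integrable_inner_gradient hφ
  have i2 := ((continuous_const (y := e)).locL2.integrable_inner_gradient hφ).const_mul m
  simp only [real_inner_smul_left] at i1
  have h3 := hP.integral_antisymmetric_flux e hφ
  have h4 : ∀ᵐ y : E N, profileExt α β R m y * inner ℝ
        (e - (inner ℝ (C • e) y • coatingGrad R y + coatingPotential R y • C • e)) (gradient φ y)
        - m * inner ℝ e (gradient φ y)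
      = β * C * ((N - 1) * coatingPotential R y * fderiv ℝ φ y e
        + inner ℝ (coatingGrad R y) y * fderiv ℝ φ y e
        - inner ℝ (coatingGrad R y) e * fderiv ℝ φ y y) := by
    filter_upwards [ae_norm_ne (N := N) hR0.ne', ae_norm_ne one_ne_zero] with y hyR hy1
    rcases lt_or_gt_of_ne hy1 with hlt1 | hgt1
    · rcases lt_or_gt_of_ne hyR with hlt | hgt
      · have hD : coatingGrad R y = 0 := if_neg fun h => hlt.not_gt h.1
        have hPy : coatingPotential R y = 1 - R ^ (-(N : ℤ)) := by
          rw [coatingPotential, clampedNorm, min_eq_left hlt1.le, max_eq_left hlt.le]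
        rw [hD, hPy, profileExt, if_pos hlt1, profile, if_pos hlt]
        simp only [smul_zero, zero_add, inner_sub_left, real_inner_smul_left,
          real_inner_gradient_right, inner_zero_left, zero_mul, add_zero, sub_zero]
        linear_combination (fderiv ℝ φ y e) * h2
      · have hy : 0 < ‖y‖ := hR0.trans hgt
        have hD : coatingGrad R y = (N * ‖y‖ ^ (-(N : ℤ) - 2)) • y := if_pos ⟨hgt, hlt1⟩
        have hPy : coatingPotential R y = 1 - ‖y‖ ^ (-(N : ℤ) - 2) * ‖y‖ ^ 2 := by
          rw [coatingPotential, clampedNorm, min_eq_left hlt1.le, max_eq_right hgt.le,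
            ← zpow_natCast, ← zpow_add₀ hy.ne']
          norm_num
        rw [hD, hPy, profileExt, if_pos hlt1, profile, if_neg hgt.not_gt]
        simp only [inner_sub_left, inner_add_left, real_inner_smul_left,
          real_inner_gradient_right, real_inner_self_eq_norm_sq, real_inner_comm y e]
        rw [h1]
        ring
    · have hD : coatingGrad R y = 0 := if_neg fun h => hgt1.not_gt h.2
      rw [hD, coatingPotential_outside hR1 hgt1.le, profileExt, if_neg hgt1.not_gt]
      simp
  have h5 := integral_congr_ae h4
  simp only [real_inner_smul_left] at h5 ⊢
  rw [integral_sub i1 i2, integral_const_mul, integral_const_mul, h3,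
    hφ.integral_inner_gradient_eq_zero] at h5
  simpa only [mul_zero, sub_zero] using h5

/-! ### The Hashin–Shtrikman constant -/

/-- The constant determined by `(m - β) / (m + (N - 1) β) = θ (α - β) / (α + (N - 1) β)` is
admissible, and the profile is equivalent to it. -/
theorem exists_hashinShtrikman (hN : 1 ≤ N) (hα : 0 < α) (hαβ : α ≤ β) (hR0 : 0 < R)
    (hR1 : R < 1) :
    ∃ m : ℝ, (α ≤ m ∧ m ≤ β) ∧ IsEquivalentTo N α β R m ∧
      ((m - β) / (m + (N - 1) * β) = R ^ N * ((α - β) / (α + (N - 1) * β)) ∧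
        ∀ m' : ℝ, m' + (N - 1) * β ≠ 0 →
          (m' - β) / (m' + (N - 1) * β) = R ^ N * ((α - β) / (α + (N - 1) * β)) → m' = m) := by
  have hβ : 0 < β := hα.trans_le hαβ
  have hn : (1 : ℝ) ≤ N := by exact_mod_cast hN
  have hS : 0 < α + (N - 1) * β := by nlinarith
  have hκ0 : 0 < R ^ N := pow_pos hR0 N
  have hκ1 : R ^ N ≤ 1 := pow_le_one₀ hR0.le hR1.le
  set τ : ℝ := (α - β) / (α + (N - 1) * β)
  set t : ℝ := R ^ N * τ with ht
  have hτS : τ * (α + (N - 1) * β) = α - β := div_mul_cancel₀ _ hS.ne'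
  have hτ0 : τ ≤ 0 := div_nonpos_of_nonpos_of_nonneg (by linarith) hS.le
  have ht0 : t ≤ 0 := mul_nonpos_of_nonneg_of_nonpos hκ0.le hτ0
  have ht1 : 0 < 1 - t := by linarith
  set m : ℝ := β * (1 + (N - 1) * t) / (1 - t) with hm
  have hmt : m * (1 - t) = β * (1 + (N - 1) * t) := div_mul_cancel₀ _ ht1.ne'
  have hαm : α ≤ m := by
    rw [hm, le_div_iff₀ ht1]
    have : t * (α + (N - 1) * β) = R ^ N * (α - β) := by rw [ht, mul_assoc, hτS]
    nlinarith
  have hmβ : m ≤ β := by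
    rw [hm, div_le_iff₀ ht1]
    nlinarith [mul_nonneg (mul_nonneg hβ.le (zero_le_one.trans hn)) (neg_nonneg.2 ht0)]
  have hm0 : 0 < m := hα.trans_le hαm
  -- eliminating `m` from the two flux conditions of `isBallSolution_explicit` gives this `C`
  refine ⟨m, ⟨hαm, hmβ⟩, ⟨hm0, fun e => ⟨_, _, isBallSolution_explicit (C := -t / (1 - t)) hR0 hR1
    ?_ ?_ e⟩⟩, ?_, fun m' hm' h => ?_⟩
  · rw [hm]
    field_simp
    ring
  · have hκ : R ^ (-(N : ℤ)) = (R ^ N)⁻¹ := by rw [zpow_neg, zpow_natCast]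
    have htκ : t * (R ^ N)⁻¹ = τ := by rw [ht]; field_simp
    have hC : -t / (1 - t) * (1 - t) = -t := div_mul_cancel₀ _ ht1.ne'
    rw [hκ]
    refine mul_right_cancel₀ ht1.ne' ?_
    have hCκ : -t / (1 - t) * (1 - (R ^ N)⁻¹) * (1 - t) = τ - t := by
      linear_combination (1 - (R ^ N)⁻¹) * hC + htκ
    linear_combination (-α - β * (N - 1)) * hCκ - hmt - hτS
  · have : 0 < m + (N - 1) * β := by nlinarith
    rw [div_eq_iff this.ne']
    linarith
  · rw [div_eq_iff hm'] at h
    refine mul_right_cancel₀ ht1.ne' ?_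
    linarith

end Explicit

theorem mainTheorem5 (N : ℕ) (hN : 1 ≤ N) (α β R : ℝ) (hα : 0 < α) (hαβ : α ≤ β)
    (hR0 : 0 < R) (hR1 : R < 1) {ι : Type*} [Countable ι] (c : ι → E N) (ρ : ι → ℝ)
    (hcover : IsPeriodicBallCover c ρ) :
    ∃ m : ℝ, (α ≤ m ∧ m ≤ β) ∧
      -- `m` is the one and only constant to which the profile is equivalent
      (IsEquivalentTo N α β R m ∧ ∀ m' : ℝ, IsEquivalentTo N α β R m' → m' = m) ∧
      -- and it is determined by the Hashin–Shtrikman relation with `θ = R ^ N`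
      ((m - β) / (m + (N - 1) * β) = R ^ N * ((α - β) / (α + (N - 1) * β)) ∧
        ∀ m' : ℝ, m' + (N - 1) * β ≠ 0 →
          (m' - β) / (m' + (N - 1) * β) = R ^ N * ((α - β) / (α + (N - 1) * β)) → m' = m) ∧
      -- the coefficient is periodic
      (∀ (k : Fin N → ℤ) (x : E N),
        hsCoeff α β R c ρ (x + latticePt k) = hsCoeff α β R c ρ x) ∧
      -- the rescaled corrector is periodic, lies in `H¹_loc`, solves the equation in the whole
      -- space, and yields the cell corrector after subtraction of its mean
      (∀ (e : E N) (w : E N → ℝ) (g : E N → E N), IsBallSolution α β R m e w g →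
        (∀ (k : Fin N → ℤ) (x : E N),
          hsCorrector c ρ e w (x + latticePt k) = hsCorrector c ρ e w x) ∧
        MemH1loc (hsCorrector c ρ e w) (hsCorrectorGrad c ρ e g) ∧
        IsDivFree (hsCoeff α β R c ρ) (fun x => hsCorrectorGrad c ρ e g x + e) ∧
        IsCellSolution (hsCoeff α β R c ρ) e
          (fun x => hsCorrector c ρ e w x - ⨍ y in unitCell N, hsCorrector c ρ e w y)
          (hsCorrectorGrad c ρ e g)) ∧
      -- the homogenized matrix, computed from the cell problem, is `m` times the identity
      (∀ (e e' : E N) (χ χ' : E N → ℝ) (g g' : E N → E N),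
        IsCellSolution (hsCoeff α β R c ρ) e χ g →
        IsCellSolution (hsCoeff α β R c ρ) e' χ' g' →
        ⨍ x in unitCell N, hsCoeff α β R c ρ x * inner ℝ (g x + e) (g' x + e')
          = m * inner ℝ e e') := by
  obtain ⟨m, hm, hequiv, hrel⟩ := exists_hashinShtrikman hN hα hαβ hR0 hR1
  refine ⟨m, hm, ⟨hequiv, fun m' h' => hequiv.unique hN h'⟩, hrel,
    fun k x => hcover.hsCoeff_add_latticePt k x, fun e w g hw =>
      ⟨fun k x => hcover.hsCorrector_add_latticePt k x, hcover.memH1loc_hsCorrector hN hw,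
        hcover.isDivFree_flux hN hw, hcover.isCellSolution_hsCorrector hN hw⟩,
    fun e e' χ χ' g g' hχ hχ' => ?_⟩
  obtain ⟨w, γ, hw⟩ := hequiv.2 e'
  exact hcover.average_flux_eq hN hw hχ hχ'
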